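/- Let $B=B_R(x_0)\subset\mathbb R^2$ be an open ball, $R>0$, and $\tfrac12B=B_{R/2}(x_0)$. For $0<\nu\le\Lambda<\infty$ let $\mathcal A_B(\nu,\Lambda)$ be the set of all $a\in L^\infty(B;\mathbb R^{2\times2})$ such that, for almost every $x\in B$, the matrix $a(x)$ is symmetric and $\nu|z|^2\le a(x)z\cdot z\le\Lambda|z|^2$ for every $z\in\mathbb R^2$. A function $v\in W^{1,2}(B)$ is a subsolution for $a$ if $\int_B a\nabla v\cdot\nabla\varphi\,dx\le0$ for all $\varphi\in C^1_c(B)$ with $\varphi\ge0$. Write $v_+=\max\{v,0\}$, and $\sup$ for the essential supremum. (i) There is a universal constant $c<\infty$ such that for every ball $B$, all $0<\nu\le\Lambda<\infty$, every $a\in\mathcal A_B(\nu,\Lambda)$ and every subsolution $v\in W^{1,2}(B)$ for $a$, $$\sup_{\frac12B}v\le c\Bigl(\frac\Lambda\nu\Bigr)^{1/4}\Bigl(\frac1{|B|}\int_B(v_+)^2\,dx\Bigr)^{1/2}.$$ (ii) The exponent $\tfrac14$ is optimal: for every ball $B$ and every real $\theta<\tfrac14$ there is no finite constant $c$ such that $\sup_{\frac12B}v\le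 c(\Lambda/\nu)^{\theta}\bigl(\frac1{|B|}\int_B(v_+)^2\,dx\bigr)^{1/2}$ holds for all $0<\nu\le\Lambda<\infty$, all $a\in\mathcal A_B(\nu,\Lambda)$ and all subsolutions $v\in W^{1,2}(B)$ for $a$. (iii) This is shown by an explicit example on the unit ball $B_1=B_1(0)$: there is $c_0>0$ such that for every $\Lambda\ge1$ the coefficient $a=\mathrm{diag}(1,\Lambda)$ belongs to $\mathcal A_{B_1}(1,\Lambda)$, the function $v(x)=1+x_2^2-\Lambda x_1^2$ is in $W^{1,2}(B_1)$ and is a subsolution for $a$, $\int_{B_1}(v_+)^2\,dx>0$, and $$\sup_{B_{1/2}}v\ge c_0\,\Lambda^{1/4}\Bigl(\frac1{|B_1|}\int_{B_1}(v_+)^2\,dx\Bigr)^{1/2}.$$ -/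

import Mathlib

open MeasureTheory Metric
open scoped ENNReal ContDiff Gradient Matrix

/-- The Euclidean plane `ℝ²` (with its Euclidean norm and Lebesgue measure). -/
abbrev Plane : Type := EuclideanSpace ℝ (Fin 2)

/-- `v ∈ L²(B)` and its distributional gradient on `B` is (represented by) the field
`G ∈ L²(B; ℝ²)`: for every `φ ∈ C_c^∞(B)` and `i = 1, 2` one has
`∫_B v ∂ᵢφ = - ∫_B φ Gᵢ`. -/
structure HasW12Gradient (B : Set Plane) (v : Plane → ℝ) (G : Plane → Plane) : Prop where
  memLp : MemLp v 2 (volume.restrict B)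
  memLp_grad : MemLp G 2 (volume.restrict B)
  integral_eq : ∀ φ : Plane → ℝ, ContDiff ℝ ∞ φ → HasCompactSupport φ → tsupport φ ⊆ B →
    ∀ i : Fin 2, ∫ x in B, v x * (∇ φ x) i = - ∫ x in B, φ x * (G x) i

/-- `v ∈ W^{1,2}(B)`. -/
def MemW12 (B : Set Plane) (v : Plane → ℝ) : Prop :=
  ∃ G : Plane → Plane, HasW12Gradient B v G

/-- `a ∈ L^∞(B; ℝ^{2×2})` is symmetric and satisfies `ν|z|² ≤ a(x)z·z ≤ Λ|z|²` for all `z`, for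
almost every `x ∈ B`. -/
structure IsEllipticOn (B : Set Plane) (ν Λ : ℝ) (a : Plane → Matrix (Fin 2) (Fin 2) ℝ) :
    Prop where
  memLp : ∀ i j, MemLp (fun x => a x i j) ∞ (volume.restrict B)
  symm : ∀ᵐ x ∂(volume.restrict B), (a x).IsSymm
  bounds : ∀ᵐ x ∂(volume.restrict B), ∀ z : Plane,
    ν * ‖z‖ ^ 2 ≤ (a x *ᵥ z.ofLp) ⬝ᵥ z.ofLp ∧ (a x *ᵥ z.ofLp) ⬝ᵥ z.ofLp ≤ Λ * ‖z‖ ^ 2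

/-- `v` is a subsolution, `-div (a ∇v) ≤ 0` in `B`: the weak gradient `G = ∇v ∈ L²` (unique up to
null sets in the open set `B`) satisfies `∫_B a ∇v · ∇φ ≤ 0` for all `0 ≤ φ ∈ C_c^1(B)`. -/
def IsSubsolution (B : Set Plane) (a : Plane → Matrix (Fin 2) (Fin 2) ℝ) (v : Plane → ℝ) :
    Prop :=
  ∃ G : Plane → Plane, HasW12Gradient B v G ∧
    ∀ φ : Plane → ℝ, ContDiff ℝ 1 φ → HasCompactSupport φ → tsupport φ ⊆ B → (∀ x, 0 ≤ φ x) →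
      ∫ x in B, (a x *ᵥ (G x).ofLp) ⬝ᵥ (∇ φ x).ofLp ≤ 0

/-- The essential supremum of a real function over a set, as an extended real number. -/
noncomputable def supOn (S : Set Plane) (v : Plane → ℝ) : EReal :=
  essSup (fun x => (v x : EReal)) (volume.restrict S)

/-- The averaged norm `(⨍_B (v_+)²)^{1/2}` of the positive part `v_+ = max {v, 0}`. -/
noncomputable def posPartAvgNorm (B : Set Plane) (v : Plane → ℝ) : ℝ :=
  (⨍ x in B, (max (v x) 0) ^ 2) ^ (1 / 2 : ℝ)

/-- With the constant `c` and the exponent `θ`, the bound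
`sup_{½B} v ≤ c (Λ/ν)^θ (⨍_B (v_+)²)^{1/2}`, `B = B_R(x₀)`, holds for all ellipticity constants
`0 < ν ≤ Λ`, all coefficient fields with these constants and all subsolutions. -/
def LocalMaxEstimate (x₀ : Plane) (R c θ : ℝ) : Prop :=
  ∀ ν Λ : ℝ, 0 < ν → ν ≤ Λ →
    ∀ a : Plane → Matrix (Fin 2) (Fin 2) ℝ, IsEllipticOn (ball x₀ R) ν Λ a →
      ∀ v : Plane → ℝ, MemW12 (ball x₀ R) v → IsSubsolution (ball x₀ R) a v →
        supOn (ball x₀ (R / 2)) v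
          ≤ ((c * (Λ / ν) ^ θ * posPartAvgNorm (ball x₀ R) v : ℝ) : EReal)

/-!
The exponent `1/4` comes from working on the boundary of a well chosen square instead of iterating
over balls. Averaging over concentric squares of radius comparable to `R` gives a frame on which the
one-dimensional Sobolev inequality for `v₊²` yields
`sup_frame v₊² ≲ R⁻² ∫ v₊² + R⁻¹ ∫ v₊ |∇v₊|`. By Caccioppoli's inequality
`‖∇v₊‖₂ ≲ R⁻¹ (Λ/ν)^{1/2} ‖v₊‖₂`, so `sup_frame v₊² ≲ (Λ/ν)^{1/2} ⨍ v₊²`, and the maximum principle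
carries this bound into the square. To make restrictions to frames meaningful, the argument is run
for `C¹` approximations of `v`, which are subsolutions up to an error that tends to zero.

The exponent is optimal because the positive part of `1 + x₂² - Λ x₁²`, whose value at the origin is
`1`, lives on a strip of width comparable to `Λ^{-1/2}`.
-/

/-! ### Smoothed positive parts -/

theorem hasDerivAt_posPart_sq (t : ℝ) :
    HasDerivAt (fun s : ℝ => (max s 0) ^ 2) (2 * max t 0) t := by
  rcases lt_trichotomy t 0 with ht | rfl | ht
  · rw [max_eq_right ht.le, mul_zero]
    refine (hasDerivAt_const t (0 : ℝ)).congr_of_eventuallyEq ?_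
    filter_upwards [gt_mem_nhds ht] with s hs
    simp [max_eq_right hs.le]
  · rw [hasDerivAt_iff_isLittleO]
    have sq_isLittleO : (fun s : ℝ => s ^ 2) =o[nhds 0] fun s : ℝ => s := by
      simpa using Asymptotics.isLittleO_pow_id (𝕜 := ℝ) one_lt_two
    refine (Asymptotics.IsBigO.of_bound 1 ?_).trans_isLittleO (by simpa using sq_isLittleO)
    filter_upwards with s
    rcases le_total s 0 with hs | hs <;> simp [hs, sq_nonneg]
  · rw [max_eq_left ht.le]
    have hasDerivAt_sq : HasDerivAt (fun s : ℝ => s ^ 2) (2 * t) t := by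
      simpa using hasDerivAt_pow 2 t
    refine hasDerivAt_sq.congr_of_eventuallyEq ?_
    filter_upwards [lt_mem_nhds ht] with s hs
    simp [max_eq_left hs.le]

theorem contDiff_posPart_sq : ContDiff ℝ 1 fun s : ℝ => (max s 0) ^ 2 := by
  rw [contDiff_one_iff_deriv]
  refine ⟨fun t => (hasDerivAt_posPart_sq t).differentiableAt, ?_⟩
  rw [funext fun t => (hasDerivAt_posPart_sq t).deriv]
  fun_prop

/-- A continuously differentiable approximation `√(ε² + t₊²) - ε` of the positive part; unlike
`t₊` itself it may be composed with `C¹` functions to give admissible test functions. -/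
noncomputable def smoothPos (ε t : ℝ) : ℝ := √(ε ^ 2 + (max t 0) ^ 2) - ε

/-- The derivative of `smoothPos ε`, see `hasDerivAt_smoothPos`. -/
noncomputable def smoothPosDeriv (ε t : ℝ) : ℝ := max t 0 / √(ε ^ 2 + (max t 0) ^ 2)

section smoothPos

variable (ε t : ℝ)

theorem smoothPosDeriv_nonneg : 0 ≤ smoothPosDeriv ε t := by
  unfold smoothPosDeriv
  positivity

theorem smoothPosDeriv_le_one : smoothPosDeriv ε t ≤ 1 :=
  div_le_one_of_le₀ (Real.le_sqrt_of_sq_le (le_add_of_nonneg_left (sq_nonneg ε)))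
    (Real.sqrt_nonneg _)

theorem smoothPos_nonneg : 0 ≤ smoothPos ε t :=
  sub_nonneg.2 (Real.le_sqrt_of_sq_le (le_add_of_nonneg_right (sq_nonneg _)))

theorem sub_le_smoothPos : t - ε ≤ smoothPos ε t :=
  sub_le_sub_right ((le_max_left t 0).trans
    (Real.le_sqrt_of_sq_le (le_add_of_nonneg_left (sq_nonneg ε)))) ε

variable {t} in
theorem smoothPos_pos (ht : 0 < t) : 0 < smoothPos ε t :=
  sub_pos.2 (Real.lt_sqrt_of_sq_lt (lt_add_of_pos_right _ (by rw [max_eq_left ht.le]; positivity)))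

variable {ε} (hε : 0 < ε)
include hε

variable {t} in
theorem smoothPos_of_nonpos (ht : t ≤ 0) : smoothPos ε t = 0 := by
  simp [smoothPos, max_eq_right ht, Real.sqrt_sq hε.le]

theorem hasDerivAt_smoothPos : HasDerivAt (smoothPos ε) (smoothPosDeriv ε t) t := by
  have radicand_ne_zero : ε ^ 2 + (max t 0) ^ 2 ≠ 0 := by positivity
  have := (((hasDerivAt_posPart_sq t).const_add (ε ^ 2)).sqrt radicand_ne_zero).sub_const ε
  exact this.congr_deriv (mul_div_mul_left _ _ two_ne_zero)

theorem continuous_smoothPosDeriv : Continuous (smoothPosDeriv ε) :=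
  Continuous.div (by fun_prop) (by fun_prop) fun s => by positivity

theorem contDiff_smoothPos : ContDiff ℝ 1 (smoothPos ε) := by
  rw [contDiff_one_iff_deriv]
  refine ⟨fun t => (hasDerivAt_smoothPos t hε).differentiableAt, ?_⟩
  rw [show deriv (smoothPos ε) = smoothPosDeriv ε from
    funext fun t => (hasDerivAt_smoothPos t hε).deriv]
  exact continuous_smoothPosDeriv hε

theorem smoothPos_le_mul : smoothPos ε t ≤ max t 0 * smoothPosDeriv ε t := by
  have sqrt_pos : 0 < √(ε ^ 2 + (max t 0) ^ 2) := by positivity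
  have le_sqrt : ε ≤ √(ε ^ 2 + (max t 0) ^ 2) :=
    Real.le_sqrt_of_sq_le (le_add_of_nonneg_right (sq_nonneg _))
  have sq_sqrt : √(ε ^ 2 + (max t 0) ^ 2) ^ 2 = ε ^ 2 + (max t 0) ^ 2 :=
    Real.sq_sqrt (by positivity)
  rw [smoothPos, smoothPosDeriv, ← mul_div_assoc, le_div_iff₀ sqrt_pos]
  nlinarith

theorem smoothPos_le_posPart : smoothPos ε t ≤ max t 0 :=
  (smoothPos_le_mul t hε).trans
    (mul_le_of_le_one_right (le_max_right _ _) (smoothPosDeriv_le_one ε t))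

theorem smoothPos_sq_le : smoothPos ε t ^ 2 ≤ (max t 0) ^ 2 * smoothPosDeriv ε t :=
  calc smoothPos ε t ^ 2 ≤ (max t 0 * smoothPosDeriv ε t) ^ 2 :=
        pow_le_pow_left₀ (smoothPos_nonneg ε t) (smoothPos_le_mul t hε) 2
    _ = (max t 0) ^ 2 * (smoothPosDeriv ε t * smoothPosDeriv ε t) := by ring
    _ ≤ (max t 0) ^ 2 * smoothPosDeriv ε t := by
        gcongr
        exact mul_le_of_le_one_right (smoothPosDeriv_nonneg ε t) (smoothPosDeriv_le_one ε t)

theorem lipschitzWith_smoothPos : LipschitzWith 1 (smoothPos ε) :=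
  lipschitzWith_of_nnnorm_deriv_le (fun t => (hasDerivAt_smoothPos t hε).differentiableAt)
    fun t => by
      rw [(hasDerivAt_smoothPos t hε).deriv, ← NNReal.coe_le_coe, coe_nnnorm,
        Real.norm_of_nonneg (smoothPosDeriv_nonneg ε t)]
      exact smoothPosDeriv_le_one ε t

end smoothPos

/-! ### Gradients -/

section gradient

theorem gradient_euclideanSpace_apply {ι : Type*} [Fintype ι] [DecidableEq ι]
    (f : EuclideanSpace ℝ ι → ℝ) (x : EuclideanSpace ℝ ι) (i : ι) :
    (∇ f x) i = fderiv ℝ f x (EuclideanSpace.single i 1) := by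
  rw [← inner_gradient_left, EuclideanSpace.inner_single_right]
  simp

variable {F : Type*} [NormedAddCommGroup F] [InnerProductSpace ℝ F] [CompleteSpace F]
  {f g : F → ℝ} {x : F}

theorem norm_gradient (f : F → ℝ) (x : F) : ‖∇ f x‖ = ‖fderiv ℝ f x‖ := by
  simp [gradient]

theorem continuous_gradient (hf : ContDiff ℝ 1 f) : Continuous (∇ f) :=
  (LinearIsometryEquiv.continuous _).comp (hf.continuous_fderiv one_ne_zero)

theorem gradient_comp {h : ℝ → ℝ} {h' : ℝ} (hh : HasDerivAt h h' (f x))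
    (hf : DifferentiableAt ℝ f x) : ∇ (fun y => h (f y)) x = h' • ∇ f x := by
  rw [gradient, gradient, ← map_smul]
  exact congrArg _ (hh.comp_hasFDerivAt x hf.hasFDerivAt).fderiv

theorem gradient_mul (hf : DifferentiableAt ℝ f x) (hg : DifferentiableAt ℝ g x) :
    ∇ (fun y => f y * g y) x = f x • ∇ g x + g x • ∇ f x := by
  simp only [gradient, fderiv_fun_mul hf hg, map_add, map_smul]

theorem gradient_eq_zero_of_notMem_tsupport (hx : x ∉ tsupport f) : ∇ f x = 0 := by
  rw [gradient, image_eq_zero_of_notMem_tsupport fun h => hx (tsupport_fderiv_subset ℝ h), map_zero]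

end gradient

/-! ### Quadratic forms -/

section form

variable {n : Type*} [Fintype n] {M : Matrix n n ℝ}

theorem dotProduct_mulVec_sq_le (hM : M.IsSymm) (hM₀ : ∀ z : n → ℝ, 0 ≤ (M *ᵥ z) ⬝ᵥ z)
    (z y : n → ℝ) : ((M *ᵥ z) ⬝ᵥ y) ^ 2 ≤ ((M *ᵥ z) ⬝ᵥ z) * ((M *ᵥ y) ⬝ᵥ y) := by
  classical
  have toBilin'_apply (z y : n → ℝ) : Matrix.toBilin' M y z = (M *ᵥ z) ⬝ᵥ y := by
    rw [Matrix.toBilin'_apply', dotProduct_comm]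
  have isSymm : LinearMap.IsSymm (Matrix.toBilin' M) := ⟨fun z y => by
    rw [RingHom.id_apply, toBilin'_apply, toBilin'_apply, dotProduct_comm, Matrix.dotProduct_mulVec,
      ← Matrix.mulVec_transpose, hM.eq]⟩
  have := LinearMap.BilinForm.apply_sq_le_of_symm (Matrix.toBilin' M)
    (fun x => by rw [toBilin'_apply]; exact hM₀ x) isSymm y z
  simpa only [toBilin'_apply, mul_comm] using this

variable {Λ : ℝ} (hΛ : 0 ≤ Λ) (hM : M.IsSymm)
  (hM₀ : ∀ z : EuclideanSpace ℝ n, 0 ≤ (M *ᵥ z.ofLp) ⬝ᵥ z.ofLp)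
  (hMΛ : ∀ z : EuclideanSpace ℝ n, (M *ᵥ z.ofLp) ⬝ᵥ z.ofLp ≤ Λ * ‖z‖ ^ 2)
  (z y : EuclideanSpace ℝ n)
include hΛ hM hM₀ hMΛ

theorem abs_dotProduct_mulVec_le : |(M *ᵥ z.ofLp) ⬝ᵥ y.ofLp| ≤ Λ * ‖z‖ * ‖y‖ := by
  refine abs_le_of_sq_le_sq ?_ (by positivity)
  calc ((M *ᵥ z.ofLp) ⬝ᵥ y.ofLp) ^ 2
      ≤ ((M *ᵥ z.ofLp) ⬝ᵥ z.ofLp) * ((M *ᵥ y.ofLp) ⬝ᵥ y.ofLp) :=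
        dotProduct_mulVec_sq_le hM (fun z => hM₀ (WithLp.toLp 2 z)) z.ofLp y.ofLp
    _ ≤ (Λ * ‖z‖ ^ 2) * (Λ * ‖y‖ ^ 2) := mul_le_mul (hMΛ z) (hMΛ y) (hM₀ y) (by positivity)
    _ = (Λ * ‖z‖ * ‖y‖) ^ 2 := by ring

/-- The pointwise absorption behind Caccioppoli's inequality. -/
theorem half_mul_sub_le_dotProduct_mulVec_add {α s t k ζ : ℝ} (hζ : 0 ≤ ζ) (hα : 0 ≤ α)
    (hk : 0 ≤ k) (hs : s ^ 2 ≤ t ^ 2 * α) (hy : ‖y‖ ^ 2 ≤ k * ζ) :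
    ζ * α / 2 * ((M *ᵥ z.ofLp) ⬝ᵥ z.ofLp) - k * Λ / 2 * t ^ 2 ≤
      (M *ᵥ z.ofLp) ⬝ᵥ ((ζ * α) • z + s • y).ofLp := by
  have expand : (M *ᵥ z.ofLp) ⬝ᵥ ((ζ * α) • z + s • y).ofLp =
      ζ * α * ((M *ᵥ z.ofLp) ⬝ᵥ z.ofLp) + s * ((M *ᵥ z.ofLp) ⬝ᵥ y.ofLp) := by
    simp [dotProduct_add, dotProduct_smul]
  have form_y_le : (M *ᵥ y.ofLp) ⬝ᵥ y.ofLp ≤ Λ * (k * ζ) :=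
    (hMΛ y).trans (mul_le_mul_of_nonneg_left hy hΛ)
  have cauchySchwarz :=
    dotProduct_mulVec_sq_le hM (fun z => hM₀ (WithLp.toLp 2 z)) z.ofLp y.ofLp
  have form_z_nonneg := hM₀ z
  rw [expand]
  set q := (M *ᵥ z.ofLp) ⬝ᵥ z.ofLp
  set p := (M *ᵥ z.ofLp) ⬝ᵥ y.ofLp
  have cross_sq_le : (s * p) ^ 2 ≤ (ζ * α * q) * (k * Λ * t ^ 2) :=
    calc (s * p) ^ 2 = s ^ 2 * p ^ 2 := by ring
      _ ≤ (t ^ 2 * α) * (q * (Λ * (k * ζ))) :=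
          mul_le_mul hs (cauchySchwarz.trans (mul_le_mul_of_nonneg_left form_y_le form_z_nonneg))
            (sq_nonneg _) (by positivity)
      _ = (ζ * α * q) * (k * Λ * t ^ 2) := by ring
  have abs_cross_le : |s * p| ≤ (ζ * α * q + k * Λ * t ^ 2) / 2 := by
    refine abs_le_of_sq_le_sq ?_ (by positivity)
    nlinarith [sq_nonneg (ζ * α * q - k * Λ * t ^ 2)]
  linarith [(abs_le.1 abs_cross_le).1]

end form

/-! ### Mollification -/

section mollification

open scoped Topology Convolution

open ContinuousLinearMap (lsmul)

theorem enorm_integral_smul_rpow_le {α F : Type*} [MeasurableSpace α] {μ : Measure α}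
    [NormedAddCommGroup F] [NormedSpace ℝ F] {ρ : α → ℝ} (hρ : Measurable ρ) (hρ₀ : ∀ t, 0 ≤ ρ t)
    (hρ₁ : ∫⁻ t, ENNReal.ofReal (ρ t) ∂μ = 1) {g : α → F} (hg : AEStronglyMeasurable g μ)
    {p : ℝ} (hp : 1 ≤ p) :
    ‖∫ t, ρ t • g t ∂μ‖ₑ ^ p ≤ ∫⁻ t, ENNReal.ofReal (ρ t) * ‖g t‖ₑ ^ p ∂μ := by
  let P : Measure α := μ.withDensity fun t => ENNReal.ofReal (ρ t)
  have : IsProbabilityMeasure P := ⟨by rw [withDensity_apply _ .univ, setLIntegral_univ, hρ₁]⟩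
  have lintegral_P (q : ℝ) :
      ∫⁻ t, ‖g t‖ₑ ^ q ∂P = ∫⁻ t, ENNReal.ofReal (ρ t) * ‖g t‖ₑ ^ q ∂μ :=
    lintegral_withDensity_eq_lintegral_mul₀ (by fun_prop) (by fun_prop)
  have enorm_le_lintegral : ‖∫ t, ρ t • g t ∂μ‖ₑ ≤ ∫⁻ t, ‖g t‖ₑ ∂P :=
    calc ‖∫ t, ρ t • g t ∂μ‖ₑ ≤ ∫⁻ t, ‖ρ t • g t‖ₑ ∂μ := enorm_integral_le_lintegral_enorm _
      _ = ∫⁻ t, ENNReal.ofReal (ρ t) * ‖g t‖ₑ ∂μ := by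
          simp_rw [enorm_smul, Real.enorm_of_nonneg (hρ₀ _)]
      _ = ∫⁻ t, ‖g t‖ₑ ∂P := by simpa using (lintegral_P 1).symm
  have jensen : ∫⁻ t, ‖g t‖ₑ ∂P ≤ (∫⁻ t, ‖g t‖ₑ ^ p ∂P) ^ p⁻¹ := by
    simpa [eLpNorm'] using eLpNorm'_le_eLpNorm'_of_exponent_le (μ := P) one_pos hp
      (hg.mono_ac (withDensity_absolutelyContinuous _ _))
  rw [← lintegral_P]
  exact (ENNReal.le_rpow_inv_iff (one_pos.trans_le hp)).1 (enorm_le_lintegral.trans jensen)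

variable {E F : Type*} [NormedAddCommGroup E] [MeasurableSpace E] [BorelSpace E] {μ : Measure E}
  [NormedAddCommGroup F] {p : ℝ≥0∞} [Fact (1 ≤ p)]

theorem tendsto_eLpNorm_translate_sub [IsLocallyFiniteMeasure μ] [μ.InnerRegularCompactLTTop]
    [μ.IsAddLeftInvariant] (hp : p ≠ ⊤) {f : E → F} (hf : MemLp f p μ) :
    Filter.Tendsto (fun t => eLpNorm (fun x => f (x - t) - f x) p μ) (𝓝 0) (𝓝 0) := by
  have : Fact (p ≠ ⊤) := ⟨hp⟩
  have continuous_translate : Continuous fun t : E => DomAddAct.mk (-t) +ᵥ hf.toLp f :=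
    (DomAddAct.continuous_mk.comp continuous_neg).vadd continuous_const
  have tendsto_edist := tendsto_iff_edist_tendsto_0.1 (continuous_translate.tendsto 0)
  refine tendsto_edist.congr fun t => ?_
  rw [neg_zero, DomAddAct.mk_zero, zero_vadd, Lp.edist_def]
  refine eLpNorm_congr_ae ?_
  filter_upwards [DomAddAct.vadd_Lp_ae_eq (DomAddAct.mk (-t)) (hf.toLp f), hf.coeFn_toLp,
    (measurePreserving_vadd (-t) μ).quasiMeasurePreserving.ae_eq_comp hf.coeFn_toLp]
    with x hx hfx hftx
  rw [Pi.sub_apply, hx, hfx]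
  simpa [sub_eq_neg_add] using congrArg (· - f x) hftx

variable [NormedSpace ℝ E] [FiniteDimensional ℝ E] [μ.IsAddHaarMeasure] [NormedSpace ℝ F]

theorem enorm_normed_convolution_sub_rpow_le [CompleteSpace F] {f : E → F}
    (hf : LocallyIntegrable f μ)
    (φ : ContDiffBump (0 : E)) (x : E) {q : ℝ} (hq : 1 ≤ q) :
    ‖(φ.normed μ ⋆[lsmul ℝ ℝ, μ] f) x - f x‖ₑ ^ q ≤
      ∫⁻ t, ENNReal.ofReal (φ.normed μ t) * ‖f (x - t) - f x‖ₑ ^ q ∂μ := by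
  have integrable_mul : Integrable (fun t => φ.normed μ t • f (x - t)) μ :=
    φ.hasCompactSupport_normed.convolutionExists_left (lsmul ℝ ℝ) φ.continuous_normed hf x
  have convolution_sub : (φ.normed μ ⋆[lsmul ℝ ℝ, μ] f) x - f x =
      ∫ t, φ.normed μ t • (f (x - t) - f x) ∂μ := by
    simp only [smul_sub]
    rw [integral_sub integrable_mul (φ.integrable_normed.smul_const _), integral_smul_const,
      φ.integral_normed, one_smul]
    rfl
  rw [convolution_sub]
  refine enorm_integral_smul_rpow_le φ.continuous_normed.measurable φ.nonneg_normed ?_ ?_ hq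
  · rw [← ofReal_integral_eq_lintegral_ofReal φ.integrable_normed (.of_forall φ.nonneg_normed),
      φ.integral_normed, ENNReal.ofReal_one]
  · exact (hf.aestronglyMeasurable.comp_quasiMeasurePreserving
      (quasiMeasurePreserving_sub_left_of_right_invariant μ x)).sub aestronglyMeasurable_const

theorem exists_forall_eLpNorm_normed_convolution_sub_le [CompleteSpace F] (hp : p ≠ ⊤) {f : E → F}
    (hf : MemLp f p μ) {ε : ℝ≥0∞} (hε : 0 < ε) :
    ∃ η : ℝ, 0 < η ∧ ∀ φ : ContDiffBump (0 : E), φ.rOut ≤ η →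
      eLpNorm (φ.normed μ ⋆[lsmul ℝ ℝ, μ] f - f) p μ ≤ ε := by
  have one_le_p : 1 ≤ p := Fact.out
  have p_ne_zero : p ≠ 0 := (one_pos.trans_le one_le_p).ne'
  have one_le_q : 1 ≤ p.toReal := by simpa using ENNReal.toReal_mono hp one_le_p
  obtain ⟨η, hη, translate_le⟩ := Metric.eventually_nhds_iff.1
    ((tendsto_eLpNorm_translate_sub hp hf).eventually (gt_mem_nhds hε))
  refine ⟨η, hη, fun φ hφ => ?_⟩
  have weighted_translate_le (t : E) :
      ENNReal.ofReal (φ.normed μ t) * ∫⁻ x, ‖f (x - t) - f x‖ₑ ^ p.toReal ∂μ ≤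
        ENNReal.ofReal (φ.normed μ t) * ε ^ p.toReal := by
    by_cases ht : t ∈ ball 0 φ.rOut
    · gcongr
      rw [← ENNReal.rpow_inv_le_iff (by positivity), ← one_div,
        ← eLpNorm_eq_lintegral_rpow_enorm_toReal p_ne_zero hp]
      exact (translate_le ((mem_ball.1 ht).trans_le hφ)).le
    · rw [← φ.support_normed_eq (μ := μ), Function.notMem_support] at ht
      simp [ht]
  rw [eLpNorm_eq_lintegral_rpow_enorm_toReal p_ne_zero hp, one_div,
    ENNReal.rpow_inv_le_iff (by positivity)]
  have aestronglyMeasurable_sub :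
      AEStronglyMeasurable (fun z : E × E => f (z.1 - z.2) - f z.1) (μ.prod μ) :=
    (hf.1.comp_quasiMeasurePreserving (quasiMeasurePreserving_sub_of_right_invariant μ μ)).sub
      hf.1.comp_fst
  have := φ.continuous_normed (μ := μ)
  calc ∫⁻ x, ‖(φ.normed μ ⋆[lsmul ℝ ℝ, μ] f) x - f x‖ₑ ^ p.toReal ∂μ
      ≤ ∫⁻ x, ∫⁻ t, ENNReal.ofReal (φ.normed μ t) * ‖f (x - t) - f x‖ₑ ^ p.toReal ∂μ ∂μ :=
        lintegral_mono fun x =>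
          enorm_normed_convolution_sub_rpow_le (hf.locallyIntegrable one_le_p) φ x one_le_q
    _ = ∫⁻ t, ENNReal.ofReal (φ.normed μ t) * ∫⁻ x, ‖f (x - t) - f x‖ₑ ^ p.toReal ∂μ ∂μ := by
        rw [lintegral_lintegral_swap]
        · exact lintegral_congr fun t => lintegral_const_mul' _ _ ENNReal.ofReal_ne_top
        · exact AEMeasurable.mul (by fun_prop) (aestronglyMeasurable_sub.enorm.pow_const _)
    _ ≤ ∫⁻ t, ENNReal.ofReal (φ.normed μ t) * ε ^ p.toReal ∂μ :=
        lintegral_mono weighted_translate_le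
    _ = ε ^ p.toReal := by
        rw [lintegral_mul_const _ (by fun_prop), ← ofReal_integral_eq_lintegral_ofReal
          φ.integrable_normed (.of_forall φ.nonneg_normed), φ.integral_normed, ENNReal.ofReal_one,
          one_mul]

theorem HasW12Gradient.gradient_convolution_indicator {B : Set Plane} {v : Plane → ℝ}
    {G : Plane → Plane} (hv : HasW12Gradient B v G) (hB : MeasurableSet B)
    (φ : ContDiffBump (0 : Plane)) {x : Plane} (hx : closedBall x φ.rOut ⊆ B) :
    ∇ (φ.normed volume ⋆[lsmul ℝ ℝ] B.indicator v) x =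
      (φ.normed volume ⋆[lsmul ℝ ℝ] B.indicator G) x := by
  set ρ := φ.normed volume with hρ
  have ρ_contDiff : ContDiff ℝ ∞ ρ := φ.contDiff_normed
  have ρ_support : HasCompactSupport ρ := φ.hasCompactSupport_normed
  have locallyIntegrable_v : LocallyIntegrable (B.indicator v) :=
    ((memLp_indicator_iff_restrict hB).2 hv.memLp).locallyIntegrable one_le_two
  have locallyIntegrable_G : LocallyIntegrable (B.indicator G) :=
    ((memLp_indicator_iff_restrict hB).2 hv.memLp_grad).locallyIntegrable one_le_two
  have exists_v := (ρ_support.fderiv ℝ).convolutionExists_left ((lsmul ℝ ℝ).precompL Plane)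
    (ρ_contDiff.continuous_fderiv (by simp)) locallyIntegrable_v x
  have exists_G := ρ_support.convolutionExists_left (lsmul ℝ ℝ) ρ_contDiff.continuous
    locallyIntegrable_G x
  have tsupport_subset : tsupport (fun y => ρ (x - y)) ⊆ closedBall x φ.rOut := by
    refine closure_minimal (fun y hy => ?_) isClosed_closedBall
    have : x - y ∈ Function.support ρ := hy
    rw [hρ, φ.support_normed_eq, mem_ball_zero_iff, ← dist_eq_norm, dist_comm] at this
    exact this.le
  ext i
  have gradient_kernel (y : Plane) :
      (∇ (fun y => ρ (x - y)) y) i = - fderiv ℝ ρ (x - y) (EuclideanSpace.single i 1) := by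
    have := (ρ_contDiff.differentiable (by simp) (x - y)).hasFDerivAt.comp y
      ((hasFDerivAt_id y).const_sub x)
    rw [gradient_euclideanSpace_apply]
    exact (DFunLike.congr_fun this.fderiv _).trans (by simp)
  have weak_gradient := hv.integral_eq (fun y => ρ (x - y)) (ρ_contDiff.comp (by fun_prop))
    (.of_isClosed_subset (isCompact_closedBall x φ.rOut) (isClosed_tsupport _) tsupport_subset)
    (tsupport_subset.trans hx) i
  simp only [gradient_kernel, mul_neg, integral_neg, neg_inj] at weak_gradient
  rw [gradient_euclideanSpace_apply, (ρ_support.hasFDerivAt_convolution_left (lsmul ℝ ℝ)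
    (ρ_contDiff.of_le (by simp)) locallyIntegrable_v x).fderiv, convolution_eq_swap,
    convolution_eq_swap, ContinuousLinearMap.integral_apply exists_v.integrable_swap,
    eval_integral_piLp exists_G.integrable_swap.eval_piLp]
  convert weak_gradient using 1
  · rw [← integral_indicator hB]
    congr! 2 with y
    by_cases hy : y ∈ B <;> simp [hy, ContinuousLinearMap.precompL, mul_comm]
  · rw [← integral_indicator hB]
    congr! 2 with y
    by_cases hy : y ∈ B <;> simp [hy]

theorem HasW12Gradient.exists_contDiff_approx {B K : Set Plane} {v : Plane → ℝ}
    {G : Plane → Plane} (hv : HasW12Gradient B v G) (hB : IsOpen B) (hK : IsCompact K)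
    (hKB : K ⊆ B) {ε : ℝ≥0∞} (hε : 0 < ε) :
    ∃ w : Plane → ℝ, ContDiff ℝ 1 w ∧ eLpNorm (w - v) 2 (volume.restrict K) ≤ ε ∧
      eLpNorm (∇ w - G) 2 (volume.restrict K) ≤ ε := by
  have memLp_v := (memLp_indicator_iff_restrict hB.measurableSet).2 hv.memLp
  have memLp_G := (memLp_indicator_iff_restrict hB.measurableSet).2 hv.memLp_grad
  obtain ⟨δ, hδ, cthickening_subset⟩ := hK.exists_cthickening_subset_open hB hKB
  obtain ⟨η, hη, approx_v⟩ :=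
    exists_forall_eLpNorm_normed_convolution_sub_le ENNReal.ofNat_ne_top memLp_v hε
  obtain ⟨η', hη', approx_G⟩ :=
    exists_forall_eLpNorm_normed_convolution_sub_le ENNReal.ofNat_ne_top memLp_G hε
  obtain ⟨r, hr, r_lt⟩ := exists_between (lt_min hδ (lt_min hη hη'))
  let φ : ContDiffBump (0 : Plane) := ⟨r / 2, r, half_pos hr, half_lt_self hr⟩
  have rOut_le : φ.rOut ≤ δ ∧ φ.rOut ≤ η ∧ φ.rOut ≤ η' := by simpa using r_lt.le
  have closedBall_subset {x : Plane} (hx : x ∈ K) : closedBall x φ.rOut ⊆ B :=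
    (closedBall_subset_cthickening hx _).trans
      ((cthickening_mono rOut_le.1 K).trans cthickening_subset)
  refine ⟨φ.normed volume ⋆[lsmul ℝ ℝ] B.indicator v,
    φ.hasCompactSupport_normed.contDiff_convolution_left _ φ.contDiff_normed
      (memLp_v.locallyIntegrable one_le_two), ?_, ?_⟩
  · refine le_trans (le_of_eq (eLpNorm_congr_ae ?_))
      ((eLpNorm_restrict_le _ 2 volume K).trans (approx_v φ rOut_le.2.1))
    filter_upwards [ae_restrict_mem hK.measurableSet] with x hx
    simp [hKB hx]
  · refine le_trans (le_of_eq (eLpNorm_congr_ae ?_))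
      ((eLpNorm_restrict_le _ 2 volume K).trans (approx_G φ rOut_le.2.2))
    filter_upwards [ae_restrict_mem hK.measurableSet] with x hx
    simp [hKB hx, hv.gradient_convolution_indicator hB.measurableSet φ (closedBall_subset hx)]

end mollification

/-! ### Frames of concentric squares -/

theorem le_integral_add_abs_deriv {f f' : ℝ → ℝ} (hf : ∀ t, HasDerivAt f (f' t) t)
    (hf' : Continuous f') {L y : ℝ} (hL : 0 < L) (hy : |y| ≤ L) :
    f y ≤ ∫ t in (-L)..L, (f t / (2 * L) + |f' t|) := by
  have continuous_f : Continuous f := continuous_iff_continuousAt.2 fun t => (hf t).continuousAt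
  have increment_le : ∀ z ∈ Set.Icc (-L) L, f y - f z ≤ ∫ t in (-L)..L, |f' t| := by
    intro z hz
    rw [← intervalIntegral.integral_eq_sub_of_hasDerivAt (fun t _ => hf t)
      (hf'.intervalIntegrable z y)]
    refine (Real.le_norm_self _).trans
      (intervalIntegral.norm_integral_le_integral_norm_uIoc.trans ?_)
    rw [intervalIntegral.integral_of_le (by linarith : -L ≤ L)]
    refine setIntegral_mono_set hf'.abs.integrableOn_Ioc (.of_forall fun t => abs_nonneg _)
      (LE.le.eventuallyLE fun t ht => ?_)
    exact ⟨(le_min hz.1 (abs_le.1 hy).1).trans_lt ht.1, ht.2.trans (max_le hz.2 (abs_le.1 hy).2)⟩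
  have averaged : ∫ z in (-L)..L, f y / (2 * L) ≤
      ∫ z in (-L)..L, (f z / (2 * L) + (∫ t in (-L)..L, |f' t|) / (2 * L)) := by
    refine intervalIntegral.integral_mono_on (by linarith) (by simp)
      (Continuous.intervalIntegrable (by fun_prop) _ _) fun z hz => ?_
    rw [← add_div]
    gcongr
    linarith [increment_le z hz]
  have length_mul_div (m : ℝ) : (L - -L) * (m / (2 * L)) = m := by field_simp; ring
  have integrable_average : IntervalIntegrable (fun z => f z / (2 * L)) volume (-L) L :=
    Continuous.intervalIntegrable (by fun_prop) _ _
  rw [intervalIntegral.integral_add integrable_average (by simp), intervalIntegral.integral_const,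
    intervalIntegral.integral_const, smul_eq_mul, smul_eq_mul, length_mul_div,
    length_mul_div] at averaged
  rwa [intervalIntegral.integral_add integrable_average (hf'.abs.intervalIntegrable _ _)]

theorem le_integral_line_add_norm_gradient {F : Type*} [NormedAddCommGroup F]
    [InnerProductSpace ℝ F] [CompleteSpace F] {u : F → ℝ} (hu : ContDiff ℝ 1 u) (p : F) {e : F}
    (he : ‖e‖ ≤ 1) {L y : ℝ} (hL : 0 < L) (hy : |y| ≤ L) :
    u (p + y • e) ≤ ∫ t in (-L)..L, (u (p + t • e) / (2 * L) + ‖∇ u (p + t • e)‖) := by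
  have continuous_u := hu.continuous
  have continuous_grad := continuous_gradient hu
  have hasDerivAt_line (t : ℝ) :
      HasDerivAt (fun t : ℝ => u (p + t • e)) (inner ℝ (∇ u (p + t • e)) e) t := by
    rw [inner_gradient_left]
    have line : HasDerivAt (fun t : ℝ => p + t • e) e t := by
      simpa using ((hasDerivAt_id t).smul_const e).const_add p
    exact (hu.differentiable one_ne_zero _).hasFDerivAt.comp_hasDerivAt t line
  refine (le_integral_add_abs_deriv hasDerivAt_line (by fun_prop) hL hy).trans
    (intervalIntegral.integral_mono_on (by linarith)
      (Continuous.intervalIntegrable (by fun_prop) _ _)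
      (Continuous.intervalIntegrable (by fun_prop) _ _) fun t _ => ?_)
  gcongr
  exact (abs_real_inner_le_norm _ _).trans (mul_le_of_le_one_right (norm_nonneg _) he)

theorem integral_add_reflect_le {f : ℝ → ℝ} (hf : Continuous f) (hf₀ : ∀ s, 0 ≤ f s) {a L : ℝ}
    (ha : 0 ≤ a) : ∫ s in a..L, (f s + f (-s)) ≤ ∫ s in (-L)..L, f s := by
  have integrable (p q : ℝ) : IntervalIntegrable f volume p q := hf.intervalIntegrable p q
  have core_nonneg : 0 ≤ ∫ s in (-a)..a, f s :=
    intervalIntegral.integral_nonneg (by linarith) fun s _ => hf₀ s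
  rw [intervalIntegral.integral_add (integrable _ _)
      (Continuous.intervalIntegrable (by fun_prop) _ _), intervalIntegral.integral_comp_neg,
    ← intervalIntegral.integral_add_adjacent_intervals (integrable (-L) (-a)) (integrable (-a) L),
    ← intervalIntegral.integral_add_adjacent_intervals (integrable (-a) a) (integrable a L)]
  linarith

/-- The distance of `x` from `c` in the maximum norm, whose level sets are the frames of the
squares centred at `c`. -/
noncomputable def squareDist (c x : Plane) : ℝ := max |x 0 - c 0| |x 1 - c 1|

/-- The integral of `ψ` over the segment of half-length `L` that is orthogonal to the `i`-th
coordinate axis and crosses the parallel through `c` to this axis at signed distance `s` from `c`.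
In `Fin 2` the other coordinate is `i + 1`. -/
noncomputable def sliceIntegral (ψ : Plane → ℝ) (c : Plane) (L : ℝ) (i : Fin 2) (s : ℝ) : ℝ :=
  ∫ t in (-L)..L,
    ψ (c + s • EuclideanSpace.single i (1 : ℝ) + t • EuclideanSpace.single (i + 1) (1 : ℝ))

section squareDist

variable (c x : Plane)

theorem continuous_squareDist : Continuous (squareDist c) := by
  unfold squareDist
  fun_prop

theorem abs_sub_le_squareDist (i : Fin 2) : |x i - c i| ≤ squareDist c x := by
  fin_cases i
  exacts [le_max_left _ _, le_max_right _ _]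

theorem exists_abs_sub_eq_squareDist : ∃ i, |x i - c i| = squareDist c x :=
  (max_choice |x 0 - c 0| |x 1 - c 1|).elim (fun h => ⟨0, h.symm⟩) fun h => ⟨1, h.symm⟩

theorem squareDist_le_dist : squareDist c x ≤ dist x c := by
  rw [dist_eq_norm]
  exact max_le (PiLp.norm_apply_le (x - c) 0) (PiLp.norm_apply_le (x - c) 1)

theorem dist_sq_le_two_mul_squareDist_sq : dist x c ^ 2 ≤ 2 * squareDist c x ^ 2 := by
  have coord_le (i : Fin 2) : ‖(x - c) i‖ ^ 2 ≤ squareDist c x ^ 2 :=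
    pow_le_pow_left₀ (norm_nonneg _) (abs_sub_le_squareDist c x i) 2
  rw [dist_eq_norm, EuclideanSpace.norm_sq_eq, Fin.sum_univ_two]
  linarith [coord_le 0, coord_le 1]

theorem eq_add_smul_single_add_smul_single (i : Fin 2) :
    x = c + (x i - c i) • EuclideanSpace.single i (1 : ℝ) +
      (x (i + 1) - c (i + 1)) • EuclideanSpace.single (i + 1) (1 : ℝ) := by
  ext j
  fin_cases i <;> fin_cases j <;> simp

variable {c} {L : ℝ} {ψ : Plane → ℝ} (hψ : Continuous ψ)

include hψ in
theorem continuous_sliceIntegral (i : Fin 2) : Continuous (sliceIntegral ψ c L i) :=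
  intervalIntegral.continuous_parametric_intervalIntegral_of_continuous'
    (by unfold Function.uncurry; fun_prop) _ _

theorem sliceIntegral_nonneg (hψ₀ : ∀ x, 0 ≤ ψ x) (hL : 0 ≤ L) (i : Fin 2) (s : ℝ) :
    0 ≤ sliceIntegral ψ c L i s :=
  intervalIntegral.integral_nonneg (by linarith) fun _ _ => hψ₀ _

theorem setIntegral_squareDist_le_eq_integral_prod :
    ∫ x in {x | squareDist c x ≤ L}, ψ x =
      ∫ p in Set.Icc (c 0 - L) (c 0 + L) ×ˢ Set.Icc (c 1 - L) (c 1 + L), ψ !₂[p.1, p.2] := by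
  let e : Plane ≃ᵐ ℝ × ℝ :=
    (MeasurableEquiv.toLp 2 (Fin 2 → ℝ)).symm.trans MeasurableEquiv.finTwoArrow
  have e_preserving : MeasurePreserving e volume volume :=
    (EuclideanSpace.volume_preserving_symm_measurableEquiv_toLp (Fin 2)).trans
      (volume_preserving_finTwoArrow ℝ)
  have square_eq : {x | squareDist c x ≤ L} =
      e ⁻¹' (Set.Icc (c 0 - L) (c 0 + L) ×ˢ Set.Icc (c 1 - L) (c 1 + L)) := by
    ext x
    change max |x 0 - c 0| |x 1 - c 1| ≤ L ↔
      x 0 ∈ Set.Icc (c 0 - L) (c 0 + L) ∧ x 1 ∈ Set.Icc (c 1 - L) (c 1 + L)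
    rw [max_le_iff, abs_sub_comm (x 0), abs_sub_comm (x 1), Set.mem_Icc_iff_abs_le,
      Set.mem_Icc_iff_abs_le]
  have ψ_eq (x : Plane) : ψ x = ψ !₂[(e x).1, (e x).2] := by
    change ψ x = ψ !₂[x 0, x 1]
    congr
    ext i
    fin_cases i <;> rfl
  rw [square_eq]
  exact (integral_congr_ae (.of_forall ψ_eq)).trans
    (e_preserving.setIntegral_preimage_emb e.measurableEmbedding
      (fun p : ℝ × ℝ => ψ !₂[p.1, p.2]) _)

include hψ

theorem setIntegral_squareDist_le (hL : 0 ≤ L) (i : Fin 2) :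
    ∫ x in {x | squareDist c x ≤ L}, ψ x = ∫ s in (-L)..L, sliceIntegral ψ c L i s := by
  have translate (f : ℝ → ℝ) (m : ℝ) :
      ∫ t in Set.Icc (m - L) (m + L), f t = ∫ t in (-L)..L, f (m + t) := by
    rw [intervalIntegral.integral_comp_add_left, integral_Icc_eq_integral_Ioc,
      intervalIntegral.integral_of_le (by linarith), sub_eq_add_neg]
  have point_eq (s t : ℝ) : (!₂[c 0 + s, c 1 + t] : Plane) =
      c + s • EuclideanSpace.single 0 1 + t • EuclideanSpace.single 1 1 := by
    ext j
    fin_cases j <;> simp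
  have vertical_slices : ∫ x in {x | squareDist c x ≤ L}, ψ x =
      ∫ s in (-L)..L, sliceIntegral ψ c L 0 s := by
    rw [setIntegral_squareDist_le_eq_integral_prod, Measure.volume_eq_prod, setIntegral_prod _
      (Continuous.continuousOn (by fun_prop) |>.integrableOn_compact
        (isCompact_Icc.prod isCompact_Icc)), translate]
    simp only [translate, point_eq]
    rfl
  fin_cases i
  · exact vertical_slices
  · rw [vertical_slices]
    unfold sliceIntegral
    have continuous_uncurry : Continuous (Function.uncurry fun s t : ℝ =>
        ψ (c + s • EuclideanSpace.single 0 1 + t • EuclideanSpace.single (0 + 1) 1)) := by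
      unfold Function.uncurry
      fun_prop
    rw [intervalIntegral_intervalIntegral_swap
      ((continuous_uncurry.continuousOn.integrableOn_compact
        (isCompact_uIcc.prod isCompact_uIcc)).mono_set
          (Set.prod_mono Set.uIoc_subset_uIcc Set.uIoc_subset_uIcc))]
    simp only [add_right_comm c]
    rfl

theorem exists_sum_sliceIntegral_le (hψ₀ : ∀ x, 0 ≤ ψ x) {a : ℝ} (ha : 0 ≤ a) (haL : a < L) :
    ∃ s ∈ Set.Icc a L, ∑ i, (sliceIntegral ψ c L i s + sliceIntegral ψ c L i (-s)) ≤
      2 / (L - a) * ∫ x in {x | squareDist c x ≤ L}, ψ x := by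
  have hL : 0 ≤ L := ha.trans haL.le
  have continuous_slice (i : Fin 2) := continuous_sliceIntegral (c := c) (L := L) hψ i
  have integral_le : ∫ s in a..L, ∑ i, (sliceIntegral ψ c L i s + sliceIntegral ψ c L i (-s)) ≤
      2 * ∫ x in {x | squareDist c x ≤ L}, ψ x := by
    rw [intervalIntegral.integral_finsetSum fun i _ =>
      Continuous.intervalIntegrable (by fun_prop) _ _]
    refine (Finset.sum_le_card_nsmul _ _ (∫ x in {x | squareDist c x ≤ L}, ψ x)
      fun i _ => ?_).trans (by simp)
    rw [setIntegral_squareDist_le hψ hL i]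
    exact integral_add_reflect_le (continuous_slice i) (sliceIntegral_nonneg hψ₀ hL i) ha
  obtain ⟨s, hs, le_average⟩ := exists_le_setAverage (μ := volume) (s := Set.Ioc a L)
    (f := fun s => ∑ i, (sliceIntegral ψ c L i s + sliceIntegral ψ c L i (-s)))
    (by simpa using haL) (by simp) (Continuous.integrableOn_Ioc (by fun_prop))
  refine ⟨s, Set.Ioc_subset_Icc_self hs, le_average.trans ?_⟩
  rw [← Set.uIoc_of_le haL.le, interval_average_eq_div, div_mul_eq_mul_div]
  gcongr

end squareDist

theorem exists_forall_squareDist_eq_le {u : Plane → ℝ} (hu : ContDiff ℝ 1 u) (hu₀ : ∀ x, 0 ≤ u x)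
    (c : Plane) {a L : ℝ} (ha : 0 ≤ a) (haL : a < L) :
    ∃ s ∈ Set.Icc a L, ∀ x, squareDist c x = s →
      u x ≤ 2 / (L - a) * ∫ x in {x | squareDist c x ≤ L}, (u x / (2 * L) + ‖∇ u x‖) := by
  have hL : 0 < L := ha.trans_lt haL
  have continuous_u := hu.continuous
  have continuous_grad := continuous_gradient hu
  set ψ : Plane → ℝ := fun x => u x / (2 * L) + ‖∇ u x‖
  have ψ_nonneg (x : Plane) : 0 ≤ ψ x :=
    add_nonneg (div_nonneg (hu₀ x) (by positivity)) (norm_nonneg _)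
  obtain ⟨s, hs, sum_le⟩ :=
    exists_sum_sliceIntegral_le (c := c) (ψ := ψ) (by fun_prop) ψ_nonneg ha haL
  refine ⟨s, hs, fun x hx => le_trans ?_ sum_le⟩
  have slice_nonneg := sliceIntegral_nonneg (c := c) ψ_nonneg hL.le
  obtain ⟨i, hi⟩ := exists_abs_sub_eq_squareDist c x
  have le_slice : u x ≤ sliceIntegral ψ c L i (x i - c i) := by
    conv_lhs => rw [eq_add_smul_single_add_smul_single c x i]
    exact le_integral_line_add_norm_gradient hu _ (by simp) hL
      ((abs_sub_le_squareDist c x _).trans (hx.le.trans hs.2))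
  have slice_le : sliceIntegral ψ c L i (x i - c i) ≤
      sliceIntegral ψ c L i s + sliceIntegral ψ c L i (-s) := by
    rcases (abs_eq (ha.trans hs.1)).1 (hi.trans hx) with h | h <;> rw [h] <;>
      linarith [slice_nonneg i s, slice_nonneg i (-s)]
  exact le_slice.trans (slice_le.trans (Finset.single_le_sum
    (fun j _ => add_nonneg (slice_nonneg j s) (slice_nonneg j (-s))) (Finset.mem_univ i)))

/-! ### Approximate subsolutions -/

section L2

variable {α : Type*} [MeasurableSpace α] {μ : Measure α}

theorem memLp_restrict_of_isCompact [TopologicalSpace α] [OpensMeasurableSpace α]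
    [IsFiniteMeasureOnCompacts μ] {E : Type*} [NormedAddCommGroup E] {f : α → E} {K : Set α}
    [SecondCountableTopologyEither α E] (hf : Continuous f) (hK : IsCompact K)
    (hK' : MeasurableSet K) (p : ℝ≥0∞) : MemLp f p (μ.restrict K) := by
  obtain ⟨C, hC⟩ := hK.exists_bound_of_continuousOn hf.continuousOn
  have : IsFiniteMeasure (μ.restrict K) := isFiniteMeasure_restrict.2 hK.measure_lt_top.ne
  exact MemLp.of_bound hf.aestronglyMeasurable C ((ae_restrict_iff' hK').2 (.of_forall hC))

theorem sq_lpNorm_two {E : Type*} [NormedAddCommGroup E] {f : α → E}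
    (hf : AEStronglyMeasurable f μ) : lpNorm f 2 μ ^ 2 = ∫ x, ‖f x‖ ^ 2 ∂μ := by
  rw [lpNorm_eq_integral_norm_rpow_toReal two_ne_zero (by simp) hf, ENNReal.toReal_ofNat,
    ← Real.rpow_natCast, ← Real.rpow_mul (by positivity)]
  simp

theorem integral_mul_le_lpNorm_mul_lpNorm {f g : α → ℝ} (hf : MemLp f 2 μ) (hg : MemLp g 2 μ) :
    ∫ x, f x * g x ∂μ ≤ lpNorm f 2 μ * lpNorm g 2 μ := by
  have hölder := integral_mul_norm_le_Lp_mul_Lq Real.HolderConjugate.two_two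
    (f := f) (g := g) (μ := μ) (by simpa using hf) (by simpa using hg)
  rw [lpNorm_eq_integral_norm_rpow_toReal two_ne_zero (by simp) hf.1,
    lpNorm_eq_integral_norm_rpow_toReal two_ne_zero (by simp) hg.1, ENNReal.toReal_ofNat]
  simp only [one_div] at hölder
  refine (integral_mono (hf.integrable_mul hg) (hf.norm.integrable_mul hg.norm) fun x => ?_).trans
    hölder
  exact (le_abs_self _).trans (abs_mul _ _).le

theorem integral_norm_mul_norm_add_le {E : Type*} [NormedAddCommGroup E] {H F : α → E}
    {f : α → ℝ} (hH : MemLp H 2 μ) (hF : MemLp F 2 μ) (hf : MemLp f 2 μ) {m : ℝ} (hm : 0 ≤ m) :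
    ∫ x, ‖H x‖ * (‖F x‖ + m * |f x|) ∂μ ≤
      lpNorm H 2 μ * (lpNorm F 2 μ + m * lpNorm f 2 μ) := by
  have norm_weight_le : lpNorm (fun x => ‖F x‖ + m * |f x|) 2 μ ≤
      lpNorm F 2 μ + m * lpNorm f 2 μ := by
    refine (lpNorm_add_le hF.norm one_le_two).trans_eq ?_
    rw [lpNorm_norm hF.1 2, ← lpNorm_fun_abs hf.1 2]
    exact congrArg _ ((lpNorm_const_smul m (fun x => |f x|) μ).trans
      (by rw [coe_nnnorm, Real.norm_of_nonneg hm]))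
  have hölder := integral_mul_le_lpNorm_mul_lpNorm hH.norm
    (hF.norm.add (hf.abs.const_mul m))
  rw [lpNorm_norm hH.1 2] at hölder
  exact hölder.trans (mul_le_mul_of_nonneg_left norm_weight_le lpNorm_nonneg)

theorem lpNorm_le_of_eLpNorm_le {E : Type*} [NormedAddCommGroup E] {f : α → E} {p : ℝ≥0∞} {c : ℝ}
    (hc : 0 ≤ c) (hf : eLpNorm f p μ ≤ ENNReal.ofReal c) : lpNorm f p μ ≤ c := by
  unfold lpNorm
  split_ifs
  exacts [ENNReal.toReal_le_of_le_ofReal hc hf, hc]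

end L2

section elliptic

variable {B D : Set Plane} {ν Λ : ℝ} {a : Plane → Matrix (Fin 2) (Fin 2) ℝ}

theorem IsEllipticOn.mono (ha : IsEllipticOn B ν Λ a) (hDB : D ⊆ B) : IsEllipticOn D ν Λ a :=
  ⟨fun i j => (ha.memLp i j).mono_measure (Measure.restrict_mono hDB le_rfl),
    ae_restrict_of_ae_restrict_of_subset hDB ha.symm,
    ae_restrict_of_ae_restrict_of_subset hDB ha.bounds⟩

variable (ha : IsEllipticOn D ν Λ a) (hν : 0 ≤ ν) (hΛ : 0 ≤ Λ)
include ha hν hΛ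

theorem IsEllipticOn.abs_form_le : ∀ᵐ x ∂volume.restrict D, ∀ z y : Plane,
    |(a x *ᵥ z.ofLp) ⬝ᵥ y.ofLp| ≤ Λ * ‖z‖ * ‖y‖ := by
  filter_upwards [ha.symm, ha.bounds] with x symm bounds
  exact abs_dotProduct_mulVec_le hΛ symm
    (fun z => (by positivity : 0 ≤ ν * ‖z‖ ^ 2).trans (bounds z).1) fun z => (bounds z).2

theorem IsEllipticOn.integrable_form {F H : Plane → Plane} (hF : MemLp F 2 (volume.restrict D))
    (hH : MemLp H 2 (volume.restrict D)) :
    IntegrableOn (fun x => (a x *ᵥ (F x).ofLp) ⬝ᵥ (H x).ofLp) D := by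
  have coord {F : Plane → Plane} (hF : MemLp F 2 (volume.restrict D)) (i : Fin 2) :
      AEStronglyMeasurable (fun x => F x i) (volume.restrict D) :=
    (EuclideanSpace.proj (𝕜 := ℝ) i).continuous.comp_aestronglyMeasurable hF.1
  refine Integrable.mono' ((hF.norm.integrable_mul hH.norm).const_mul Λ) ?_ ?_
  · simp only [dotProduct, Matrix.mulVec]
    exact Finset.aestronglyMeasurable_fun_sum _ fun i _ =>
      (Finset.aestronglyMeasurable_fun_sum _ fun j _ => (ha.memLp i j).1.mul (coord hF j)).mul
        (coord hH i)
  · filter_upwards [ha.abs_form_le hν hΛ] with x form_le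
    exact (form_le (F x) (H x)).trans_eq (mul_assoc _ _ _)

theorem IsEllipticOn.integral_form_le {F G H : Plane → Plane}
    (hF : MemLp F 2 (volume.restrict D)) (hG : MemLp G 2 (volume.restrict D))
    (hH : MemLp H 2 (volume.restrict D)) :
    ∫ x in D, (a x *ᵥ (F x).ofLp) ⬝ᵥ (H x).ofLp ≤
      (∫ x in D, (a x *ᵥ (G x).ofLp) ⬝ᵥ (H x).ofLp) + Λ * ∫ x in D, ‖F x - G x‖ * ‖H x‖ := by
  have integrable_error : IntegrableOn (fun x => ‖F x - G x‖ * ‖H x‖) D :=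
    (hF.sub hG).norm.integrable_mul hH.norm
  rw [← integral_const_mul, ← integral_add (ha.integrable_form hν hΛ hG hH)
    (integrable_error.const_mul Λ)]
  refine integral_mono_ae (ha.integrable_form hν hΛ hF hH)
    ((ha.integrable_form hν hΛ hG hH).add (integrable_error.const_mul Λ)) ?_
  filter_upwards [ha.abs_form_le hν hΛ] with x form_le
  have split : (a x *ᵥ (F x).ofLp) ⬝ᵥ (H x).ofLp =
      (a x *ᵥ (G x).ofLp) ⬝ᵥ (H x).ofLp + (a x *ᵥ (F x - G x).ofLp) ⬝ᵥ (H x).ofLp := by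
    rw [← add_dotProduct, ← Matrix.mulVec_add, WithLp.ofLp_sub, add_sub_cancel]
  rw [split]
  gcongr
  exact ((le_abs_self _).trans (form_le _ _)).trans_eq (mul_assoc _ _ _)

end elliptic

theorem HasW12Gradient.exists_contDiff_integral_le {B D : Set Plane} {v : Plane → ℝ}
    {G : Plane → Plane} (hv : HasW12Gradient B v G) (hB : IsOpen B) (hD : IsCompact D)
    (hDB : D ⊆ B) {m δ : ℝ} (hm : 0 ≤ m) (hδ : 0 < δ) :
    ∃ w, ContDiff ℝ 1 w ∧ ∫ x in D, (w x - v x) ^ 2 ≤ δ ∧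
      ∫ x in D, ‖∇ w x - G x‖ * (‖∇ w x‖ + m * |w x|) ≤ δ := by
  set μ := volume.restrict D with hμ
  have μ_le : μ ≤ volume.restrict B := Measure.restrict_mono hDB le_rfl
  have memLp_v : MemLp v 2 μ := hv.memLp.mono_measure μ_le
  have memLp_G : MemLp G 2 μ := hv.memLp_grad.mono_measure μ_le
  set N := lpNorm G 2 μ + 1 + m * (lpNorm v 2 μ + 1)
  have N_pos : 0 < N := by
    have := lpNorm_nonneg (f := G) (p := 2) (μ := μ)
    have := lpNorm_nonneg (f := v) (p := 2) (μ := μ)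
    positivity
  set η := min 1 (min δ (δ / N))
  have η_pos : 0 < η := by positivity
  have η_le_one : η ≤ 1 := min_le_left _ _
  obtain ⟨w, hw, hwv, hwG⟩ :=
    hv.exists_contDiff_approx hB hD hDB (ENNReal.ofReal_pos.2 η_pos)
  have memLp_w : MemLp w 2 μ := memLp_restrict_of_isCompact hw.continuous hD hD.measurableSet 2
  have memLp_grad : MemLp (∇ w) 2 μ :=
    memLp_restrict_of_isCompact (continuous_gradient hw) hD hD.measurableSet 2
  have norm_sub_v_le : lpNorm (w - v) 2 μ ≤ η := lpNorm_le_of_eLpNorm_le η_pos.le hwv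
  have norm_sub_G_le : lpNorm (∇ w - G) 2 μ ≤ η := lpNorm_le_of_eLpNorm_le η_pos.le hwG
  have norm_w_le : lpNorm w 2 μ ≤ lpNorm v 2 μ + 1 :=
    (lpNorm_le_lpNorm_add_lpNorm_sub memLp_v one_le_two).trans
      (by rw [lpNorm_sub_comm]; gcongr; exact norm_sub_v_le.trans η_le_one)
  have norm_grad_le : lpNorm (∇ w) 2 μ ≤ lpNorm G 2 μ + 1 :=
    (lpNorm_le_lpNorm_add_lpNorm_sub memLp_G one_le_two).trans
      (by rw [lpNorm_sub_comm]; gcongr; exact norm_sub_G_le.trans η_le_one)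
  refine ⟨w, hw, ?_, ?_⟩
  · calc ∫ x in D, (w x - v x) ^ 2 = lpNorm (w - v) 2 μ ^ 2 := by
          rw [sq_lpNorm_two (memLp_w.sub memLp_v).1]
          simp [hμ]
      _ ≤ η ^ 2 := pow_le_pow_left₀ lpNorm_nonneg norm_sub_v_le 2
      _ ≤ η := pow_le_of_le_one η_pos.le η_le_one two_ne_zero
      _ ≤ δ := (min_le_right _ _).trans (min_le_left _ _)
  · calc ∫ x in D, ‖∇ w x - G x‖ * (‖∇ w x‖ + m * |w x|)
        ≤ lpNorm (∇ w - G) 2 μ * (lpNorm (∇ w) 2 μ + m * lpNorm w 2 μ) :=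
          integral_norm_mul_norm_add_le (memLp_grad.sub memLp_G) memLp_grad memLp_w hm
      _ ≤ δ / N * N := by
          refine mul_le_mul (norm_sub_G_le.trans ((min_le_right _ _).trans (min_le_right _ _)))
            (add_le_add norm_grad_le (mul_le_mul_of_nonneg_left norm_w_le hm)) ?_ (by positivity)
          exact add_nonneg lpNorm_nonneg (mul_nonneg hm lpNorm_nonneg)
      _ = δ := div_mul_cancel₀ δ N_pos.ne'

/-- `w` is a smooth function that satisfies the inequality defining subsolutions on `D` up to an
error `δ`, for the nonnegative test functions `φ` with `|∇φ| ≤ |∇w| + m |w|`. The test functions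
`ζ g(w)` and `(w - K)₊` of the energy estimates below are of this kind, and restricting to such `φ`
makes every subsolution a limit of approximate ones with `δ → 0`. -/
structure IsApproxSubsolution (D : Set Plane) (a : Plane → Matrix (Fin 2) (Fin 2) ℝ) (m δ : ℝ)
    (w : Plane → ℝ) : Prop where
  contDiff : ContDiff ℝ 1 w
  integral_form_le : ∀ φ : Plane → ℝ, ContDiff ℝ 1 φ → tsupport φ ⊆ D → (∀ x, 0 ≤ φ x) →
    (∀ x, ‖∇ φ x‖ ≤ ‖∇ w x‖ + m * |w x|) →
      ∫ x in D, (a x *ᵥ (∇ w x).ofLp) ⬝ᵥ (∇ φ x).ofLp ≤ δ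

theorem IsSubsolution.exists_isApproxSubsolution {B D : Set Plane} {ν Λ : ℝ} {v : Plane → ℝ}
    {a : Plane → Matrix (Fin 2) (Fin 2) ℝ} (hv : IsSubsolution B a v) (ha : IsEllipticOn B ν Λ a)
    (hν : 0 ≤ ν) (hΛ : 0 ≤ Λ) (hB : IsOpen B) (hD : IsCompact D) (hDB : D ⊆ B) {m δ : ℝ}
    (hm : 0 ≤ m) (hδ : 0 < δ) :
    ∃ w, IsApproxSubsolution D a m δ w ∧ ∫ x in D, (w x - v x) ^ 2 ≤ δ := by
  obtain ⟨G, hG, sub⟩ := hv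
  obtain ⟨w, hw, hwv, hwG⟩ := hG.exists_contDiff_integral_le hB hD hDB hm
    (δ := min δ (δ / (Λ + 1))) (by positivity)
  refine ⟨w, ⟨hw, fun φ hφ hφD hφ₀ grad_φ_le => ?_⟩, hwv.trans (min_le_left _ _)⟩
  have memLp_G : MemLp G 2 (volume.restrict D) :=
    hG.memLp_grad.mono_measure (Measure.restrict_mono hDB le_rfl)
  have memLp_of_continuous {E : Type} [NormedAddCommGroup E] {f : Plane → E}
      (hf : Continuous f) : MemLp f 2 (volume.restrict D) :=
    memLp_restrict_of_isCompact hf hD hD.measurableSet 2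
  have memLp_grad := memLp_of_continuous (continuous_gradient hw)
  have memLp_grad_φ := memLp_of_continuous (continuous_gradient hφ)
  have test : ∫ x in D, (a x *ᵥ (G x).ofLp) ⬝ᵥ (∇ φ x).ofLp ≤ 0 := by
    rw [← setIntegral_eq_of_subset_of_forall_sdiff_eq_zero hB.measurableSet hDB fun x hx => by
      rw [gradient_eq_zero_of_notMem_tsupport fun h => hx.2 (hφD h)]
      simp]
    exact sub φ hφ (hD.of_isClosed_subset (isClosed_tsupport φ) hφD) (hφD.trans hDB) hφ₀
  have error_le : ∫ x in D, ‖∇ w x - G x‖ * ‖∇ φ x‖ ≤ δ / (Λ + 1) := by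
    refine (integral_mono ((memLp_grad.sub memLp_G).norm.integrable_mul memLp_grad_φ.norm)
      ((memLp_grad.sub memLp_G).norm.integrable_mul (memLp_of_continuous
        (f := fun x => ‖∇ w x‖ + m * |w x|) ?_)) fun x => ?_).trans
          (hwG.trans (min_le_right _ _))
    · exact (continuous_gradient hw).norm.add (continuous_const.mul hw.continuous.abs)
    · exact mul_le_mul_of_nonneg_left (grad_φ_le x) (norm_nonneg _)
  calc ∫ x in D, (a x *ᵥ (∇ w x).ofLp) ⬝ᵥ (∇ φ x).ofLp
      ≤ (∫ x in D, (a x *ᵥ (G x).ofLp) ⬝ᵥ (∇ φ x).ofLp) +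
          Λ * ∫ x in D, ‖∇ w x - G x‖ * ‖∇ φ x‖ :=
        (ha.mono hDB).integral_form_le hν hΛ memLp_grad memLp_G memLp_grad_φ
    _ ≤ 0 + Λ * (δ / (Λ + 1)) := by gcongr
    _ ≤ δ := by
        rw [zero_add, mul_div_left_comm]
        exact mul_le_of_le_one_right hδ.le (div_le_one_of_le₀ (by linarith) (by positivity))

/-! ### Caccioppoli's inequality -/

section testFunction

variable {F : Type*} [NormedAddCommGroup F] [InnerProductSpace ℝ F] [CompleteSpace F]
  {ζ w : F → ℝ} {x : F} {ε m : ℝ} (hζ : DifferentiableAt ℝ ζ x) (hw : DifferentiableAt ℝ w x)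
  (hε : 0 < ε)
include hw hε

theorem gradient_smoothPos_sub (K : ℝ) :
    ∇ (fun y => smoothPos ε (w y - K)) x = smoothPosDeriv ε (w x - K) • ∇ w x :=
  gradient_comp ((hasDerivAt_smoothPos (w x - K) hε).comp_sub_const (w x) K) hw

include hζ

theorem gradient_mul_smoothPos : ∇ (fun y => ζ y * smoothPos ε (w y)) x =
    (ζ x * smoothPosDeriv ε (w x)) • ∇ w x + smoothPos ε (w x) • ∇ ζ x := by
  have hasDerivAt_smoothPos_w := hasDerivAt_smoothPos (w x) hε
  have differentiableAt_comp : DifferentiableAt ℝ (fun y => smoothPos ε (w y)) x :=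
    hasDerivAt_smoothPos_w.differentiableAt.comp x hw
  rw [gradient_mul hζ differentiableAt_comp, gradient_comp hasDerivAt_smoothPos_w hw, smul_smul]

theorem norm_gradient_mul_smoothPos_le (hζ₀ : 0 ≤ ζ x) (hζ₁ : ζ x ≤ 1) (hζm : ‖∇ ζ x‖ ≤ m) :
    ‖∇ (fun y => ζ y * smoothPos ε (w y)) x‖ ≤ ‖∇ w x‖ + m * |w x| := by
  rw [gradient_mul_smoothPos hζ hw hε]
  refine (norm_add_le _ _).trans (add_le_add ?_ ?_)
  · rw [norm_smul, Real.norm_of_nonneg (mul_nonneg hζ₀ (smoothPosDeriv_nonneg ε _))]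
    exact mul_le_of_le_one_left (norm_nonneg _)
      (mul_le_one₀ hζ₁ (smoothPosDeriv_nonneg ε _) (smoothPosDeriv_le_one ε _))
  · rw [norm_smul, Real.norm_of_nonneg (smoothPos_nonneg ε _), mul_comm]
    exact mul_le_mul hζm ((smoothPos_le_posPart _ hε).trans
      (max_le (le_abs_self _) (abs_nonneg _))) (smoothPos_nonneg ε _) ((norm_nonneg _).trans hζm)

end testFunction

section IsApproxSubsolution

variable {D : Set Plane} {a : Plane → Matrix (Fin 2) (Fin 2) ℝ} {m δ ν Λ : ℝ} {w : Plane → ℝ}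
  (hw : IsApproxSubsolution D a m δ w) (ha : IsEllipticOn D ν Λ a) (hν : 0 ≤ ν) (hΛ : 0 ≤ Λ)
  (hD : IsCompact D) (hm : 0 ≤ m) {ε : ℝ} (hε : 0 < ε)
include hw ha hν hΛ hD hm hε

theorem IsApproxSubsolution.caccioppoli {ζ : Plane → ℝ} (hζ : ContDiff ℝ 1 ζ)
    (hζD : tsupport ζ ⊆ D) (hζ₀ : ∀ x, 0 ≤ ζ x) (hζ₁ : ∀ x, ζ x ≤ 1)
    (hζm : ∀ x, ‖∇ ζ x‖ ^ 2 ≤ m ^ 2 * ζ x) :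
    ν * ∫ x in D, ζ x * smoothPosDeriv ε (w x) * ‖∇ w x‖ ^ 2 ≤
      m ^ 2 * Λ * (∫ x in D, (max (w x) 0) ^ 2) + 2 * δ := by
  have continuous_w := hw.contDiff.continuous
  have continuous_grad := continuous_gradient hw.contDiff
  have continuous_deriv := continuous_smoothPosDeriv hε
  have continuous_ζ := hζ.continuous
  have differentiable_ζ := hζ.differentiable one_ne_zero
  have differentiable_w := hw.contDiff.differentiable one_ne_zero
  set φ : Plane → ℝ := fun x => ζ x * smoothPos ε (w x) with φ_def
  have hφ : ContDiff ℝ 1 φ := hζ.mul ((contDiff_smoothPos hε).comp hw.contDiff)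
  have norm_gradient_ζ_le (x : Plane) : ‖∇ ζ x‖ ≤ m := le_of_sq_le_sq
    ((hζm x).trans (mul_le_of_le_one_right (sq_nonneg m) (hζ₁ x))) hm
  have integrable {f : Plane → ℝ} (hf : Continuous f) : IntegrableOn f D :=
    hf.continuousOn.integrableOn_compact hD
  have integrable_form : IntegrableOn (fun x => (a x *ᵥ (∇ w x).ofLp) ⬝ᵥ (∇ φ x).ofLp) D :=
    ha.integrable_form hν hΛ (memLp_restrict_of_isCompact continuous_grad hD hD.measurableSet 2)
      (memLp_restrict_of_isCompact (continuous_gradient hφ) hD hD.measurableSet 2)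
  have form_ge : ∫ x in D, (ν / 2 * (ζ x * smoothPosDeriv ε (w x) * ‖∇ w x‖ ^ 2) -
      m ^ 2 * Λ / 2 * (max (w x) 0) ^ 2) ≤ ∫ x in D, (a x *ᵥ (∇ w x).ofLp) ⬝ᵥ (∇ φ x).ofLp := by
    refine integral_mono_ae (integrable (by fun_prop)) integrable_form ?_
    filter_upwards [ha.symm, ha.bounds] with x symm bounds
    have weight_nonneg : 0 ≤ ζ x * smoothPosDeriv ε (w x) / 2 :=
      div_nonneg (mul_nonneg (hζ₀ x) (smoothPosDeriv_nonneg ε _)) two_pos.le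
    have absorbed := half_mul_sub_le_dotProduct_mulVec_add hΛ symm
      (fun z => (by positivity : 0 ≤ ν * ‖z‖ ^ 2).trans (bounds z).1) (fun z => (bounds z).2)
      (∇ w x) (∇ ζ x) (hζ₀ x) (smoothPosDeriv_nonneg ε (w x)) (sq_nonneg m)
      (smoothPos_sq_le (w x) hε) (hζm x)
    rw [φ_def, gradient_mul_smoothPos (differentiable_ζ x) (differentiable_w x) hε]
    linarith [mul_le_mul_of_nonneg_left (bounds (∇ w x)).1 weight_nonneg]
  have tested := hw.integral_form_le φ hφ (tsupport_mul_subset_left.trans hζD)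
    (fun x => mul_nonneg (hζ₀ x) (smoothPos_nonneg ε _)) fun x =>
      norm_gradient_mul_smoothPos_le (differentiable_ζ x) (differentiable_w x) hε (hζ₀ x) (hζ₁ x)
        (norm_gradient_ζ_le x)
  rw [integral_sub (integrable (by fun_prop)) (integrable (by fun_prop)), integral_const_mul,
    integral_const_mul] at form_ge
  linarith

end IsApproxSubsolution

/-- The `C¹` cutoff function `((1 - |x - x₀|² / r²)₊)²` of the ball `B_r(x₀)`. -/
noncomputable def cutoff {F : Type*} [NormedAddCommGroup F] (x₀ : F) (r : ℝ) (x : F) : ℝ :=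
  (max (1 - ‖x - x₀‖ ^ 2 / r ^ 2) 0) ^ 2

section cutoff

variable {F : Type*} [NormedAddCommGroup F] (x₀ : F) (r : ℝ)

theorem cutoff_nonneg (x : F) : 0 ≤ cutoff x₀ r x := sq_nonneg _

theorem cutoff_le_one (x : F) : cutoff x₀ r x ≤ 1 :=
  pow_le_one₀ (le_max_right _ _)
    (max_le (sub_le_self 1 (div_nonneg (sq_nonneg _) (sq_nonneg r))) zero_le_one)

theorem contDiff_cutoff [InnerProductSpace ℝ F] : ContDiff ℝ 1 (cutoff x₀ r) :=
  contDiff_posPart_sq.comp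
    (contDiff_const.sub (((contDiff_id.sub contDiff_const).norm_sq ℝ).div_const _))

variable {r} (hr : 0 < r)
include hr

theorem norm_sub_lt_of_pos {x : F} (hx : 0 < 1 - ‖x - x₀‖ ^ 2 / r ^ 2) : ‖x - x₀‖ < r := by
  rw [sub_pos, div_lt_one (by positivity)] at hx
  exact lt_of_pow_lt_pow_left₀ 2 hr.le hx

theorem tsupport_cutoff_subset : tsupport (cutoff x₀ r) ⊆ closedBall x₀ r := by
  refine closure_minimal (fun x hx => ?_) isClosed_closedBall
  rw [mem_closedBall, dist_eq_norm]
  by_contra! r_lt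
  have nonpos : 1 - ‖x - x₀‖ ^ 2 / r ^ 2 ≤ 0 :=
    not_lt.1 fun h => r_lt.not_gt (norm_sub_lt_of_pos x₀ hr h)
  exact hx (by simp [cutoff, max_eq_right nonpos])

theorem sq_one_sub_le_cutoff {x : F} {θ : ℝ} (hθ : θ ≤ 1) (hx : ‖x - x₀‖ ^ 2 ≤ θ * r ^ 2) :
    (1 - θ) ^ 2 ≤ cutoff x₀ r x :=
  pow_le_pow_left₀ (sub_nonneg.2 hθ)
    (le_max_of_le_left (sub_le_sub_left ((div_le_iff₀ (by positivity)).2 hx) 1)) 2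

theorem norm_gradient_cutoff_sq_le [InnerProductSpace ℝ F] [CompleteSpace F] (x : F) :
    ‖∇ (cutoff x₀ r) x‖ ^ 2 ≤ (4 / r) ^ 2 * cutoff x₀ r x := by
  set p : F → ℝ := fun x => 1 - ‖x - x₀‖ ^ 2 / r ^ 2
  have hasGradientAt_p : HasGradientAt p (-(2 / r ^ 2) • (x - x₀)) x := by
    rw [hasGradientAt_iff_hasFDerivAt]
    refine ((((hasFDerivAt_id x).sub_const x₀).norm_sq.mul_const (r ^ 2)⁻¹).const_sub
      1).congr_fderiv ?_
    ext y
    simp only [id_eq, ContinuousLinearMap.comp_id, neg_apply, smul_apply,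
      coe_innerSL_apply, nsmul_eq_mul, Nat.cast_ofNat, smul_eq_mul, neg_smul, map_neg, map_smul,
      InnerProductSpace.toDual_apply_apply]
    ring
  have gradient_cutoff : ∇ (cutoff x₀ r) x = (2 * max (p x) 0) • -(2 / r ^ 2) • (x - x₀) := by
    rw [← hasGradientAt_p.gradient]
    exact gradient_comp (hasDerivAt_posPart_sq (p x)) hasGradientAt_p.differentiableAt
  rw [gradient_cutoff, show cutoff x₀ r x = (max (p x) 0) ^ 2 from rfl]
  rcases le_or_gt (p x) 0 with hp | hp
  · simp [max_eq_right hp]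
  · rw [max_eq_left hp.le]
    have norm_le : ‖x - x₀‖ ≤ r := (norm_sub_lt_of_pos x₀ hr hp).le
    calc ‖(2 * p x) • -(2 / r ^ 2) • (x - x₀)‖ ^ 2
        = (4 / r ^ 2) ^ 2 * ‖x - x₀‖ ^ 2 * p x ^ 2 := by
          simp only [norm_smul, norm_neg, norm_mul, Real.norm_eq_abs, mul_pow, sq_abs]
          ring
      _ ≤ (4 / r ^ 2) ^ 2 * r ^ 2 * p x ^ 2 := by gcongr
      _ = (4 / r) ^ 2 * p x ^ 2 := by
          field_simp

end cutoff

/-! ### The maximum principle -/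

theorem exists_integral_sq_le_integral_norm_gradient_sq {D : Set Plane} (hD : IsCompact D) :
    ∃ C, 0 ≤ C ∧ ∀ φ : Plane → ℝ, ContDiff ℝ 1 φ → tsupport φ ⊆ D →
      ∫ x in D, φ x ^ 2 ≤ C * ∫ x in D, ‖∇ φ x‖ ^ 2 := by
  set S := eLpNormLESNormFDerivOneConst (volume : Measure Plane) 2
  set V := volume D ^ (1 / 2 : ℝ)
  have V_ne_top : V ≠ ⊤ := ENNReal.rpow_ne_top_of_nonneg (by norm_num) hD.measure_lt_top.ne
  refine ⟨(S * V.toReal) ^ 2, sq_nonneg _, fun φ hφ hφD => ?_⟩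
  have memLp {E : Type} [NormedAddCommGroup E] {f : Plane → E} (hf : Continuous f) :
      MemLp f 2 (volume.restrict D) := memLp_restrict_of_isCompact hf hD hD.measurableSet 2
  have memLp_φ := memLp hφ.continuous
  have memLp_grad := memLp (continuous_gradient hφ)
  have support_grad_subset : Function.support (∇ φ) ⊆ D := fun x hx => by
    by_contra hxD
    exact hx (gradient_eq_zero_of_notMem_tsupport fun h => hxD (hφD h))
  have holderConjugate : NNReal.HolderConjugate (Module.finrank ℝ Plane) 2 := by
    rw [finrank_euclideanSpace_fin]
    exact_mod_cast NNReal.HolderConjugate.two_two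
  have eLpNorm_le : eLpNorm φ 2 (volume.restrict D) ≤
      S * (eLpNorm (∇ φ) 2 (volume.restrict D) * V) :=
    calc eLpNorm φ 2 (volume.restrict D) ≤ eLpNorm φ 2 volume := eLpNorm_restrict_le _ _ _ _
      _ ≤ S * eLpNorm (fderiv ℝ φ) 1 volume :=
          eLpNorm_le_eLpNorm_fderiv_one volume hφ
            (hD.of_isClosed_subset (isClosed_tsupport φ) hφD) holderConjugate
      _ = S * eLpNorm (∇ φ) 1 (volume.restrict D) := by
          rw [eLpNorm_restrict_eq_of_support_subset support_grad_subset]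
          exact congrArg _ (eLpNorm_congr_norm_ae (.of_forall fun x => (norm_gradient φ x).symm))
      _ ≤ S * (eLpNorm (∇ φ) 2 (volume.restrict D) * V) := by
          gcongr
          refine (eLpNorm_le_eLpNorm_mul_rpow_measure_univ one_le_two memLp_grad.1).trans_eq ?_
          rw [Measure.restrict_apply_univ]
          norm_num [V]
  have lpNorm_le : lpNorm φ 2 (volume.restrict D) ≤
      S * V.toReal * lpNorm (∇ φ) 2 (volume.restrict D) := by
    have := ENNReal.toReal_mono (by finiteness [memLp_grad.2.ne]) eLpNorm_le
    rw [ENNReal.toReal_mul, ENNReal.toReal_mul, toReal_eLpNorm memLp_φ.1,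
      toReal_eLpNorm memLp_grad.1] at this
    exact this.trans_eq (by rw [ENNReal.coe_toReal]; ring)
  have := pow_le_pow_left₀ lpNorm_nonneg lpNorm_le 2
  rw [mul_pow, sq_lpNorm_two memLp_φ.1, sq_lpNorm_two memLp_grad.1] at this
  simpa using this

section indicator

variable {F : Type*} [NormedAddCommGroup F] {S : Set F} {f : F → ℝ} (hS : IsOpen S)
  (hf₀ : ∀ x ∈ frontier S, f =ᶠ[nhds x] 0)
include hS hf₀

theorem indicator_eventuallyEq_self_or_zero (x : F) :
    x ∈ S ∧ S.indicator f =ᶠ[nhds x] f ∨ x ∉ S ∧ S.indicator f =ᶠ[nhds x] 0 := by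
  by_cases hxS : x ∈ S
  · refine Or.inl ⟨hxS, ?_⟩
    filter_upwards [hS.mem_nhds hxS] with y hy using Set.indicator_of_mem hy f
  · refine Or.inr ⟨hxS, ?_⟩
    by_cases hx : x ∈ closure S
    · filter_upwards [hf₀ x (hS.frontier_eq ▸ ⟨hx, hxS⟩)] with y hy
      exact (Set.indicator_apply_eq_zero (s := S)).2 fun _ => hy
    · filter_upwards [isClosed_closure.isOpen_compl.mem_nhds hx] with y hy
      exact Set.indicator_of_notMem (fun h => hy (subset_closure h)) f

theorem contDiff_indicator [NormedSpace ℝ F] {n : WithTop ℕ∞} (hf : ContDiff ℝ n f) :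
    ContDiff ℝ n (S.indicator f) := by
  refine contDiff_iff_contDiffAt.2 fun x => ?_
  rcases indicator_eventuallyEq_self_or_zero hS hf₀ x with ⟨-, h⟩ | ⟨-, h⟩
  · exact hf.contDiffAt.congr_of_eventuallyEq h
  · exact contDiffAt_const.congr_of_eventuallyEq h

theorem gradient_indicator [InnerProductSpace ℝ F] [CompleteSpace F] :
    ∇ (S.indicator f) = S.indicator (∇ f) := by
  ext1 x
  rcases indicator_eventuallyEq_self_or_zero hS hf₀ x with ⟨hx, h⟩ | ⟨hx, h⟩
  · rw [Set.indicator_of_mem hx, gradient, gradient, h.fderiv_eq]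
  · rw [Set.indicator_of_notMem hx, gradient, h.fderiv_eq]
    simp

end indicator

section IsApproxSubsolution

variable {D S : Set Plane} {a : Plane → Matrix (Fin 2) (Fin 2) ℝ} {m δ ν Λ : ℝ} {w : Plane → ℝ}
  (hw : IsApproxSubsolution D a m δ w) (ha : IsEllipticOn D ν Λ a) (hν : 0 ≤ ν) (hΛ : 0 ≤ Λ)
  (hD : IsCompact D) (hm : 0 ≤ m) (hS : IsOpen S) (hSD : S ⊆ D) {K ε : ℝ} (hε : 0 < ε)
  (hK : ∀ x ∈ frontier S, w x < K)

include hw hε hK in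
theorem IsApproxSubsolution.smoothPos_sub_eventuallyEq_zero :
    ∀ x ∈ frontier S, (fun y => smoothPos ε (w y - K)) =ᶠ[nhds x] 0 := fun x hx => by
  filter_upwards [hw.contDiff.continuous.continuousAt.eventually (gt_mem_nhds (hK x hx))] with y hy
  exact smoothPos_of_nonpos hε (by linarith)

include hw ha hν hΛ hD hm hS hSD hε hK in
theorem IsApproxSubsolution.integral_norm_gradient_indicator_sq_le :
    ν * ∫ x in D, ‖∇ (S.indicator fun y => smoothPos ε (w y - K)) x‖ ^ 2 ≤ δ := by
  have vanish := hw.smoothPos_sub_eventuallyEq_zero hε hK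
  set φ := S.indicator fun y => smoothPos ε (w y - K)
  have hφ : ContDiff ℝ 1 φ := contDiff_indicator hS vanish
    ((contDiff_smoothPos hε).comp (hw.contDiff.sub contDiff_const))
  have gradient_φ (x : Plane) :
      ∇ φ x = S.indicator (fun x => smoothPosDeriv ε (w x - K)) x • ∇ w x := by
    rw [gradient_indicator hS vanish, ← Set.indicator_smul_apply_left]
    exact congrFun (congrArg _ (funext fun y => gradient_smoothPos_sub
      (hw.contDiff.differentiable one_ne_zero y) hε K)) x
  set α := S.indicator fun x => smoothPosDeriv ε (w x - K)
  have α_nonneg (x : Plane) : 0 ≤ α x :=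
    Set.indicator_nonneg (fun y _ => smoothPosDeriv_nonneg ε (w y - K)) x
  have α_le_one (x : Plane) : α x ≤ 1 :=
    Set.indicator_apply_le' (fun _ => smoothPosDeriv_le_one ε _) fun _ => zero_le_one
  have norm_gradient_φ (x : Plane) : ‖∇ φ x‖ = α x * ‖∇ w x‖ := by
    rw [gradient_φ, norm_smul, Real.norm_of_nonneg (α_nonneg x)]
  have norm_gradient_φ_le (x : Plane) : ‖∇ φ x‖ ≤ ‖∇ w x‖ + m * |w x| := by
    rw [norm_gradient_φ]
    exact le_add_of_le_of_nonneg (mul_le_of_le_one_left (norm_nonneg _) (α_le_one x))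
      (by positivity)
  have tsupport_φ : tsupport φ ⊆ D :=
    closure_minimal (Set.support_indicator_subset.trans hSD) hD.isClosed
  have continuous_grad_φ := continuous_gradient hφ
  refine le_trans ?_ (hw.integral_form_le φ hφ tsupport_φ
    (Set.indicator_nonneg fun x _ => smoothPos_nonneg ε _) norm_gradient_φ_le)
  rw [← integral_const_mul]
  refine integral_mono_ae ((Continuous.continuousOn (by fun_prop)).integrableOn_compact hD)
    (ha.integrable_form hν hΛ
      (memLp_restrict_of_isCompact (continuous_gradient hw.contDiff) hD hD.measurableSet 2)
      (memLp_restrict_of_isCompact continuous_grad_φ hD hD.measurableSet 2)) ?_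
  filter_upwards [ha.bounds] with x bounds
  rw [norm_gradient_φ, gradient_φ, WithLp.ofLp_smul, dotProduct_smul, smul_eq_mul]
  calc ν * (α x * ‖∇ w x‖) ^ 2 = α x * (α x * (ν * ‖∇ w x‖ ^ 2)) := by ring
    _ ≤ α x * (ν * ‖∇ w x‖ ^ 2) :=
        mul_le_mul_of_nonneg_left (mul_le_of_le_one_left (by positivity) (α_le_one x)) (α_nonneg x)
    _ ≤ α x * ((a x *ᵥ (∇ w x).ofLp) ⬝ᵥ (∇ w x).ofLp) :=
        mul_le_mul_of_nonneg_left (bounds _).1 (α_nonneg x)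

include hw ha hν hΛ hD hm hS hSD hε hK in
theorem IsApproxSubsolution.integral_smoothPos_sub_sq_le {C : ℝ} (hC : 0 ≤ C)
    (poincare : ∀ φ : Plane → ℝ, ContDiff ℝ 1 φ → tsupport φ ⊆ D →
      ∫ x in D, φ x ^ 2 ≤ C * ∫ x in D, ‖∇ φ x‖ ^ 2) :
    ν * ∫ x in S, smoothPos ε (w x - K) ^ 2 ≤ C * δ := by
  have gradient_le := hw.integral_norm_gradient_indicator_sq_le ha hν hΛ hD hm hS hSD hε hK
  have indicator_sq (x : Plane) : (S.indicator (fun y => smoothPos ε (w y - K)) x) ^ 2 =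
      S.indicator (fun y => smoothPos ε (w y - K) ^ 2) x := by
    by_cases hx : x ∈ S <;> simp [hx]
  have poincare_φ := poincare _
    (contDiff_indicator hS (hw.smoothPos_sub_eventuallyEq_zero hε hK)
      ((contDiff_smoothPos hε).comp (hw.contDiff.sub contDiff_const)))
    (closure_minimal (Set.support_indicator_subset.trans hSD) hD.isClosed)
  simp only [indicator_sq] at poincare_φ
  rw [setIntegral_indicator hS.measurableSet, Set.inter_eq_right.2 hSD] at poincare_φ
  calc ν * ∫ x in S, smoothPos ε (w x - K) ^ 2
      ≤ ν * (C * ∫ x in D, ‖∇ (S.indicator fun y => smoothPos ε (w y - K)) x‖ ^ 2) :=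
        mul_le_mul_of_nonneg_left poincare_φ hν
    _ = C * (ν * ∫ x in D, ‖∇ (S.indicator fun y => smoothPos ε (w y - K)) x‖ ^ 2) := by ring
    _ ≤ C * δ := mul_le_mul_of_nonneg_left gradient_le hC

end IsApproxSubsolution

/-! ### The local maximum estimate -/

theorem norm_gradient_smoothPos_sq_le {F : Type*} [NormedAddCommGroup F] [InnerProductSpace ℝ F]
    [CompleteSpace F] {w : F → ℝ} {x : F} {ε κ : ℝ} (hw : DifferentiableAt ℝ w x) (hε : 0 < ε)
    (hκ : 0 < κ) : ‖∇ (fun y => smoothPos ε (w y) ^ 2) x‖ ≤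
      κ * (max (w x) 0) ^ 2 + κ⁻¹ * (smoothPosDeriv ε (w x) * ‖∇ w x‖ ^ 2) := by
  have deriv_nonneg := smoothPosDeriv_nonneg ε (w x)
  have deriv_le_one := smoothPosDeriv_le_one ε (w x)
  have hasDerivAt_sq : HasDerivAt (fun t => smoothPos ε t ^ 2)
      (2 * smoothPos ε (w x) * smoothPosDeriv ε (w x)) (w x) := by
    simpa using (hasDerivAt_smoothPos (w x) hε).fun_pow 2
  have young : 2 * max (w x) 0 * ‖∇ w x‖ ≤ κ * (max (w x) 0) ^ 2 + κ⁻¹ * ‖∇ w x‖ ^ 2 := by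
    have : 0 ≤ κ⁻¹ * (κ * max (w x) 0 - ‖∇ w x‖) ^ 2 := by positivity
    refine le_of_sub_nonneg (this.trans_eq ?_)
    field_simp
    ring
  calc ‖∇ (fun y => smoothPos ε (w y) ^ 2) x‖
      = 2 * smoothPos ε (w x) * smoothPosDeriv ε (w x) * ‖∇ w x‖ := by
        rw [gradient_comp hasDerivAt_sq hw, norm_smul, Real.norm_of_nonneg
          (mul_nonneg (mul_nonneg two_pos.le (smoothPos_nonneg ε _)) deriv_nonneg)]
    _ ≤ 2 * max (w x) 0 * smoothPosDeriv ε (w x) * ‖∇ w x‖ := by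
        gcongr
        exact smoothPos_le_posPart _ hε
    _ = smoothPosDeriv ε (w x) * (2 * max (w x) 0 * ‖∇ w x‖) := by ring
    _ ≤ smoothPosDeriv ε (w x) * (κ * (max (w x) 0) ^ 2 + κ⁻¹ * ‖∇ w x‖ ^ 2) := by gcongr
    _ = smoothPosDeriv ε (w x) * (κ * (max (w x) 0) ^ 2) +
          κ⁻¹ * (smoothPosDeriv ε (w x) * ‖∇ w x‖ ^ 2) := by ring
    _ ≤ κ * (max (w x) 0) ^ 2 + κ⁻¹ * (smoothPosDeriv ε (w x) * ‖∇ w x‖ ^ 2) := by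
        exact add_le_add_left (mul_le_of_le_one_left (by positivity) deriv_le_one) _

theorem dist_sq_le_of_squareDist_le {x₀ x : Plane} {r : ℝ}
    (hx : squareDist x₀ x ≤ 2 / 3 * r) : dist x x₀ ^ 2 ≤ 8 / 9 * r ^ 2 := by
  have squareDist_nonneg : 0 ≤ squareDist x₀ x :=
    (abs_nonneg _).trans (abs_sub_le_squareDist x₀ x 0)
  have := pow_le_pow_left₀ squareDist_nonneg hx 2
  linarith [dist_sq_le_two_mul_squareDist_sq x₀ x]

theorem squareDist_le_subset_closedBall {x₀ : Plane} {r : ℝ} (hr : 0 < r) :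
    {x | squareDist x₀ x ≤ 2 / 3 * r} ⊆ closedBall x₀ r := fun x hx => by
  refine le_of_sq_le_sq ((dist_sq_le_of_squareDist_le hx).trans ?_) hr.le
  exact mul_le_of_le_one_left (sq_nonneg r) (by norm_num)

theorem setIntegral_squareDist_sq_add_norm_gradient_le {w : Plane → ℝ} (hw : ContDiff ℝ 1 w)
    {x₀ : Plane} {r ε κ : ℝ} (hr : 0 < r) (hε : 0 < ε) (hκ : 1 ≤ κ) :
    ∫ x in {x | squareDist x₀ x ≤ 2 / 3 * r},
        (smoothPos ε (w x) ^ 2 / (2 * (2 / 3 * r)) + ‖∇ (fun y => smoothPos ε (w y) ^ 2) x‖) ≤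
      2 * (κ / r) * (∫ x in closedBall x₀ r, (max (w x) 0) ^ 2) + (κ / r)⁻¹ *
        ∫ x in {x | squareDist x₀ x ≤ 2 / 3 * r}, smoothPosDeriv ε (w x) * ‖∇ w x‖ ^ 2 := by
  have continuous_w := hw.continuous
  have continuous_grad := continuous_gradient hw
  have continuous_deriv := continuous_smoothPosDeriv hε
  have contDiff_comp := (contDiff_smoothPos hε).comp hw
  have continuous_comp : Continuous fun x => smoothPos ε (w x) := contDiff_comp.continuous
  have continuous_grad_sq : Continuous (∇ fun x => smoothPos ε (w x) ^ 2) :=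
    continuous_gradient (contDiff_comp.pow 2)
  have subset := squareDist_le_subset_closedBall (x₀ := x₀) hr
  have integrable_closedBall {f : Plane → ℝ} (hf : Continuous f) :
      IntegrableOn f (closedBall x₀ r) :=
    hf.continuousOn.integrableOn_compact (isCompact_closedBall x₀ r)
  have integrable {f : Plane → ℝ} (hf : Continuous f) :
      IntegrableOn f {x | squareDist x₀ x ≤ 2 / 3 * r} :=
    (integrable_closedBall hf).mono_set subset
  have posPart_le : ∫ x in {x | squareDist x₀ x ≤ 2 / 3 * r}, (max (w x) 0) ^ 2 ≤
      ∫ x in closedBall x₀ r, (max (w x) 0) ^ 2 :=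
    setIntegral_mono_set (integrable_closedBall (by fun_prop))
      (.of_forall fun x => sq_nonneg _) subset.eventuallyLE
  have sq_div_le (x : Plane) :
      smoothPos ε (w x) ^ 2 / (2 * (2 / 3 * r)) ≤ κ / r * (max (w x) 0) ^ 2 := by
    have sq_le : smoothPos ε (w x) ^ 2 ≤ (max (w x) 0) ^ 2 :=
      pow_le_pow_left₀ (smoothPos_nonneg ε _) (smoothPos_le_posPart _ hε) 2
    calc smoothPos ε (w x) ^ 2 / (2 * (2 / 3 * r)) ≤ 1 * (max (w x) 0) ^ 2 / r := by
          rw [one_mul]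
          gcongr
          linarith
      _ ≤ κ * (max (w x) 0) ^ 2 / r := by gcongr
      _ = κ / r * (max (w x) 0) ^ 2 := (div_mul_eq_mul_div _ _ _).symm
  calc _ ≤ ∫ x in {x | squareDist x₀ x ≤ 2 / 3 * r}, (2 * (κ / r) * (max (w x) 0) ^ 2 +
          (κ / r)⁻¹ * (smoothPosDeriv ε (w x) * ‖∇ w x‖ ^ 2)) := by
        refine integral_mono (integrable (by fun_prop)) (integrable (by fun_prop)) fun x => ?_
        have := norm_gradient_smoothPos_sq_le (hw.differentiable one_ne_zero x) hε
          (by positivity : 0 < κ / r)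
        dsimp only
        linarith [sq_div_le x]
    _ ≤ _ := by
        rw [integral_add (integrable (by fun_prop)) (integrable (by fun_prop)),
          integral_const_mul, integral_const_mul]
        exact add_le_add_left (mul_le_mul_of_nonneg_left posPart_le (by positivity)) _

section IsApproxSubsolution

variable {x₀ : Plane} {r δ ν Λ ε : ℝ} {a : Plane → Matrix (Fin 2) (Fin 2) ℝ} {w : Plane → ℝ}
  (hw : IsApproxSubsolution (closedBall x₀ r) a (4 / r) δ w)
  (ha : IsEllipticOn (closedBall x₀ r) ν Λ a) (hr : 0 < r) (hε : 0 < ε)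
include hw ha hr hε

theorem IsApproxSubsolution.setIntegral_squareDist_le (hν : 0 ≤ ν) (hΛ : 0 ≤ Λ) :
    ν * ∫ x in {x | squareDist x₀ x ≤ 2 / 3 * r}, smoothPosDeriv ε (w x) * ‖∇ w x‖ ^ 2 ≤
      81 * ((4 / r) ^ 2 * Λ * (∫ x in closedBall x₀ r, (max (w x) 0) ^ 2) + 2 * δ) := by
  have continuous_w := hw.contDiff.continuous
  have continuous_grad := continuous_gradient hw.contDiff
  have continuous_deriv := continuous_smoothPosDeriv hε
  have continuous_cutoff := (contDiff_cutoff x₀ r).continuous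
  have nonneg (x : Plane) : 0 ≤ smoothPosDeriv ε (w x) * ‖∇ w x‖ ^ 2 :=
    mul_nonneg (smoothPosDeriv_nonneg ε _) (sq_nonneg _)
  have subset := squareDist_le_subset_closedBall (x₀ := x₀) hr
  have integrable {f : Plane → ℝ} (hf : Continuous f) : IntegrableOn f (closedBall x₀ r) :=
    hf.continuousOn.integrableOn_compact (isCompact_closedBall x₀ r)
  have integrable_cutoff : IntegrableOn (fun x => 81 * (cutoff x₀ r x *
      smoothPosDeriv ε (w x) * ‖∇ w x‖ ^ 2)) (closedBall x₀ r) := integrable (by fun_prop)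
  have one_le_cutoff {x : Plane} (hx : squareDist x₀ x ≤ 2 / 3 * r) :
      1 ≤ 81 * cutoff x₀ r x := by
    have := sq_one_sub_le_cutoff x₀ hr (θ := 8 / 9) (by norm_num)
      (dist_eq_norm x x₀ ▸ dist_sq_le_of_squareDist_le hx)
    linarith
  have cutoff_le :
      ∫ x in {x | squareDist x₀ x ≤ 2 / 3 * r}, smoothPosDeriv ε (w x) * ‖∇ w x‖ ^ 2 ≤
        81 * ∫ x in closedBall x₀ r, cutoff x₀ r x * smoothPosDeriv ε (w x) * ‖∇ w x‖ ^ 2 := by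
    rw [← integral_const_mul]
    refine (setIntegral_mono_on (integrable (by fun_prop) |>.mono_set subset)
      (integrable_cutoff.mono_set subset)
      (measurableSet_le (continuous_squareDist x₀).measurable measurable_const)
      fun x hx => ?_).trans
        (setIntegral_mono_set integrable_cutoff (.of_forall fun x => ?_) subset.eventuallyLE)
    · calc _ ≤ 81 * cutoff x₀ r x * (smoothPosDeriv ε (w x) * ‖∇ w x‖ ^ 2) :=
            le_mul_of_one_le_left (nonneg x) (one_le_cutoff hx)
        _ = _ := by ring
    · have := mul_nonneg (cutoff_nonneg x₀ r x) (nonneg x)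
      simp only [Pi.zero_apply]
      linarith
  have caccioppoli := hw.caccioppoli ha hν hΛ (isCompact_closedBall x₀ r) (by positivity) hε
    (contDiff_cutoff x₀ r) (tsupport_cutoff_subset x₀ hr) (cutoff_nonneg x₀ r)
    (cutoff_le_one x₀ r) (norm_gradient_cutoff_sq_le x₀ hr)
  linarith [mul_le_mul_of_nonneg_left cutoff_le hν]

variable (hν : 0 < ν) (hΛ : ν ≤ Λ)
include hν hΛ

theorem IsApproxSubsolution.exists_forall_smoothPos_sq_le :
    ∃ s ∈ Set.Icc (5 / 9 * r) (2 / 3 * r), ∀ x, squareDist x₀ x = s → smoothPos ε (w x) ^ 2 ≤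
      √(Λ / ν) * (23364 / r ^ 2 * ∫ x in closedBall x₀ r, (max (w x) 0) ^ 2) +
        2916 * δ / √(ν * Λ) := by
  obtain ⟨s, hs, frame_le⟩ := exists_forall_squareDist_eq_le
    (((contDiff_smoothPos hε).comp hw.contDiff).pow 2) (fun x => sq_nonneg _) x₀
    (by positivity : 0 ≤ 5 / 9 * r) (by linarith : 5 / 9 * r < 2 / 3 * r)
  refine ⟨s, hs, fun x hx => (frame_le x hx).trans ?_⟩
  rw [show 2 / 3 * r - 5 / 9 * r = r / 9 by ring]
  have energy_le := hw.setIntegral_squareDist_le ha hr hε hν.le (hν.le.trans hΛ)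
  set W := ∫ x in closedBall x₀ r, (max (w x) 0) ^ 2
  set X := ∫ x in {x | squareDist x₀ x ≤ 2 / 3 * r}, smoothPosDeriv ε (w x) * ‖∇ w x‖ ^ 2
  set l := √(Λ / ν)
  have one_le_l : 1 ≤ l := Real.one_le_sqrt.2 ((one_le_div hν).2 hΛ)
  have Λ_eq : Λ = l ^ 2 * ν := by
    rw [Real.sq_sqrt (div_nonneg (hν.le.trans hΛ) hν.le), div_mul_cancel₀ Λ hν.ne']
  have sqrt_eq : √(ν * Λ) = l * ν := by
    rw [Λ_eq, show ν * (l ^ 2 * ν) = (l * ν) ^ 2 by ring, Real.sqrt_sq (by positivity)]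
  have X_le : X ≤ 81 * ((4 / r) ^ 2 * l ^ 2 * W + 2 * δ / ν) := by
    refine le_of_mul_le_mul_left (energy_le.trans_eq ?_) hν
    rw [Λ_eq]
    field_simp
  calc _ ≤ 2 / (r / 9) * (2 * (l / r) * W + (l / r)⁻¹ * X) :=
        mul_le_mul_of_nonneg_left
          (setIntegral_squareDist_sq_add_norm_gradient_le hw.contDiff hr hε one_le_l)
          (by positivity)
    _ ≤ 2 / (r / 9) * (2 * (l / r) * W +
          (l / r)⁻¹ * (81 * ((4 / r) ^ 2 * l ^ 2 * W + 2 * δ / ν))) := by gcongr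
    _ = l * (23364 / r ^ 2 * W) + 2916 * δ / √(ν * Λ) := by
        rw [sqrt_eq]
        field_simp
        ring

theorem IsApproxSubsolution.exists_forall_lt {M : ℝ} (hM : 0 ≤ M)
    (hW : √(Λ / ν) * (23364 / r ^ 2 * ∫ x in closedBall x₀ r, (max (w x) 0) ^ 2) +
      2916 * δ / √(ν * Λ) ≤ M ^ 2 + ε ^ 2) :
    ∃ s ∈ Set.Icc (5 / 9 * r) (2 / 3 * r), ∀ x, squareDist x₀ x = s → w x < M + 3 * ε := by
  obtain ⟨s, hs, frame_le⟩ := hw.exists_forall_smoothPos_sq_le ha hr hε hν hΛ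
  refine ⟨s, hs, fun x hx => ?_⟩
  have smoothPos_le : smoothPos ε (w x) ≤ M + ε :=
    le_of_sq_le_sq (by nlinarith [frame_le x hx, mul_nonneg hM hε.le]) (by positivity)
  linarith [sub_le_smoothPos ε (w x)]

theorem IsApproxSubsolution.setIntegral_ball_smoothPos_sub_sq_le {M C : ℝ} (hM : 0 ≤ M)
    (hW : √(Λ / ν) * (23364 / r ^ 2 * ∫ x in closedBall x₀ r, (max (w x) 0) ^ 2) +
      2916 * δ / √(ν * Λ) ≤ M ^ 2 + ε ^ 2) (hC : 0 ≤ C)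
    (poincare : ∀ φ : Plane → ℝ, ContDiff ℝ 1 φ → tsupport φ ⊆ closedBall x₀ r →
      ∫ x in closedBall x₀ r, φ x ^ 2 ≤ C * ∫ x in closedBall x₀ r, ‖∇ φ x‖ ^ 2) :
    ∫ x in ball x₀ (5 / 9 * r), smoothPos ε (w x - (M + 3 * ε)) ^ 2 ≤ C / ν * δ := by
  obtain ⟨s, hs, frame_lt⟩ := hw.exists_forall_lt ha hr hε hν hΛ hM hW
  have continuous_w := hw.contDiff.continuous
  have continuous_smoothPos := (contDiff_smoothPos hε).continuous
  have isOpen_square : IsOpen {x | squareDist x₀ x < s} :=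
    isOpen_lt (continuous_squareDist x₀) continuous_const
  have square_subset : {x | squareDist x₀ x < s} ⊆ closedBall x₀ r := fun x hx =>
    squareDist_le_subset_closedBall hr ((le_of_lt hx).trans hs.2)
  have ball_subset : ball x₀ (5 / 9 * r) ⊆ {x | squareDist x₀ x < s} := fun x hx =>
    ((squareDist_le_dist x₀ x).trans_lt hx).trans_le hs.1
  have maximum_principle := hw.integral_smoothPos_sub_sq_le ha hν.le (hν.le.trans hΛ)
    (isCompact_closedBall x₀ r) (by positivity) isOpen_square square_subset hε (K := M + 3 * ε)
    (fun x hx => frame_lt x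
      (frontier_lt_subset_eq (continuous_squareDist x₀) continuous_const hx)) hC poincare
  refine (setIntegral_mono_set ?_ (.of_forall fun x => sq_nonneg _) ball_subset.eventuallyLE).trans
    ?_
  · exact ((Continuous.continuousOn (by fun_prop)).integrableOn_compact
      (isCompact_closedBall x₀ r)).mono_set square_subset
  · rw [div_mul_eq_mul_div, le_div_iff₀ hν, mul_comm]
    exact maximum_principle

end IsApproxSubsolution

theorem integral_sq_comp_le {α : Type*} [MeasurableSpace α] {μ : Measure α} {f g : α → ℝ}
    {h : ℝ → ℝ} (hh : LipschitzWith 1 h) (h0 : h 0 = 0) (hf : MemLp f 2 μ) (hg : MemLp g 2 μ) :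
    ∫ x, h (f x) ^ 2 ∂μ ≤ 2 * (∫ x, h (g x) ^ 2 ∂μ) + 2 * ∫ x, (g x - f x) ^ 2 ∂μ := by
  have integrable_f : Integrable (fun x => h (f x) ^ 2) μ := (hh.comp_memLp h0 hf).integrable_sq
  have integrable_g : Integrable (fun x => h (g x) ^ 2) μ := (hh.comp_memLp h0 hg).integrable_sq
  have integrable_sub : Integrable (fun x => (g x - f x) ^ 2) μ := (hg.sub hf).integrable_sq
  rw [← integral_const_mul, ← integral_const_mul,
    ← integral_add (integrable_g.const_mul 2) (integrable_sub.const_mul 2)]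
  refine integral_mono integrable_f ((integrable_g.const_mul 2).add (integrable_sub.const_mul 2))
    fun x => ?_
  have sq_sub_le : (h (g x) - h (f x)) ^ 2 ≤ (g x - f x) ^ 2 :=
    sq_le_sq.2 (by simpa [Real.dist_eq] using hh.dist_le_mul (g x) (f x))
  dsimp only
  nlinarith [sq_nonneg (2 * h (g x) - h (f x))]

theorem lipschitzWith_smoothPos_sub {ε : ℝ} (hε : 0 < ε) (K : ℝ) :
    LipschitzWith 1 fun t => smoothPos ε (t - K) := by
  simpa [Function.comp_def] using
    (lipschitzWith_smoothPos hε).comp (IsometryEquiv.subRight K).isometry.lipschitz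

section IsSubsolution

variable {x₀ : Plane} {R r ν Λ M ε : ℝ} {a : Plane → Matrix (Fin 2) (Fin 2) ℝ} {v : Plane → ℝ}
  (hv : IsSubsolution (ball x₀ R) a v) (ha : IsEllipticOn (ball x₀ R) ν Λ a) (hν : 0 < ν)
  (hΛ : ν ≤ Λ) (hr : 0 < r) (hrR : r < R) (hM : 0 ≤ M)
  (hMv : √(Λ / ν) * (46728 / r ^ 2 * ∫ x in ball x₀ R, (max (v x) 0) ^ 2) ≤ M ^ 2)
include hv hrR

theorem IsSubsolution.memLp_closedBall : MemLp v 2 (volume.restrict (closedBall x₀ r)) := by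
  obtain ⟨G, hG, -⟩ := hv
  exact hG.memLp.mono_measure (Measure.restrict_mono (closedBall_subset_ball hrR) le_rfl)

theorem IsSubsolution.setIntegral_posPart_sq_le {w : Plane → ℝ} {δ : ℝ}
    (hw : MemLp w 2 (volume.restrict (closedBall x₀ r)))
    (hwv : ∫ x in closedBall x₀ r, (w x - v x) ^ 2 ≤ δ) :
    ∫ x in closedBall x₀ r, (max (w x) 0) ^ 2 ≤
      2 * (∫ x in ball x₀ R, (max (v x) 0) ^ 2) + 2 * δ := by
  have comp_le := integral_sq_comp_le (LipschitzWith.id.max_const 0) (max_self 0) hw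
    (hv.memLp_closedBall hrR)
  have mono : ∫ x in closedBall x₀ r, (max (v x) 0) ^ 2 ≤ ∫ x in ball x₀ R, (max (v x) 0) ^ 2 := by
    obtain ⟨G, hG, -⟩ := hv
    exact setIntegral_mono_set hG.memLp.pos_part.integrable_sq (.of_forall fun x => sq_nonneg _)
      (closedBall_subset_ball hrR).eventuallyLE
  have sub_comm : ∫ x in closedBall x₀ r, (v x - w x) ^ 2 =
      ∫ x in closedBall x₀ r, (w x - v x) ^ 2 := by
    simp only [sub_sq_comm]
  simp only [id] at comp_le
  linarith

include ha hν hΛ hr hM hMv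

theorem IsSubsolution.setIntegral_smoothPos_sub_sq_le (hε : 0 < ε) {C δ : ℝ} (hC : 0 ≤ C)
    (poincare : ∀ φ : Plane → ℝ, ContDiff ℝ 1 φ → tsupport φ ⊆ closedBall x₀ r →
      ∫ x in closedBall x₀ r, φ x ^ 2 ≤ C * ∫ x in closedBall x₀ r, ‖∇ φ x‖ ^ 2)
    (hδ : 0 < δ) (hδε : (√(Λ / ν) * (46728 / r ^ 2) + 2916 / √(ν * Λ)) * δ ≤ ε ^ 2) :
    ∫ x in ball x₀ (5 / 9 * r), smoothPos ε (v x - (M + 3 * ε)) ^ 2 ≤ (2 * (C / ν) + 2) * δ := by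
  obtain ⟨w, hw, hwv⟩ := hv.exists_isApproxSubsolution ha hν.le (hν.le.trans hΛ) isOpen_ball
    (isCompact_closedBall x₀ r) (closedBall_subset_ball hrR) (by positivity : 0 ≤ 4 / r) hδ
  have ball_subset : ball x₀ (5 / 9 * r) ⊆ closedBall x₀ r :=
    ball_subset_closedBall.trans (closedBall_subset_closedBall (by linarith))
  have restrict_le := Measure.restrict_mono (μ := volume) ball_subset le_rfl
  have memLp_v := hv.memLp_closedBall hrR
  have memLp_w : MemLp w 2 (volume.restrict (closedBall x₀ r)) :=
    memLp_restrict_of_isCompact hw.contDiff.continuous (isCompact_closedBall x₀ r)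
      measurableSet_closedBall 2
  have height_le : √(Λ / ν) * (23364 / r ^ 2 * ∫ x in closedBall x₀ r, (max (w x) 0) ^ 2) +
      2916 * δ / √(ν * Λ) ≤ M ^ 2 + ε ^ 2 := by
    calc _ ≤ √(Λ / ν) * (23364 / r ^ 2 *
            (2 * (∫ x in ball x₀ R, (max (v x) 0) ^ 2) + 2 * δ)) + 2916 * δ / √(ν * Λ) := by
          gcongr
          exact hv.setIntegral_posPart_sq_le hrR memLp_w hwv
      _ = √(Λ / ν) * (46728 / r ^ 2 * ∫ x in ball x₀ R, (max (v x) 0) ^ 2) +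
            (√(Λ / ν) * (46728 / r ^ 2) + 2916 / √(ν * Λ)) * δ := by ring
      _ ≤ M ^ 2 + ε ^ 2 := add_le_add hMv hδε
  have approx_le := hw.setIntegral_ball_smoothPos_sub_sq_le (ha.mono (closedBall_subset_ball hrR))
    hr hε hν hΛ hM height_le hC poincare
  have sq_sub_le : ∫ x in ball x₀ (5 / 9 * r), (w x - v x) ^ 2 ≤ δ :=
    (setIntegral_mono_set (memLp_w.sub memLp_v).integrable_sq (.of_forall fun x => sq_nonneg _)
      ball_subset.eventuallyLE).trans hwv
  have comp_le := integral_sq_comp_le (lipschitzWith_smoothPos_sub hε (M + 3 * ε))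
    (smoothPos_of_nonpos hε (by linarith)) (memLp_v.mono_measure restrict_le)
    (memLp_w.mono_measure restrict_le)
  linarith

theorem IsSubsolution.setIntegral_smoothPos_sub_sq_eq_zero (hε : 0 < ε) :
    ∫ x in ball x₀ (5 / 9 * r), smoothPos ε (v x - (M + 3 * ε)) ^ 2 = 0 := by
  obtain ⟨C, hC, poincare⟩ :=
    exists_integral_sq_le_integral_norm_gradient_sq (isCompact_closedBall x₀ r)
  have tendsto_mul (P : ℝ) : Filter.Tendsto (P * ·) (nhdsWithin 0 (Set.Ioi 0)) (nhds 0) :=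
    (Continuous.tendsto' (by fun_prop) 0 0 (mul_zero P)).mono_left nhdsWithin_le_nhds
  refine le_antisymm (ge_of_tendsto (tendsto_mul (2 * (C / ν) + 2)) ?_)
    (integral_nonneg fun x => sq_nonneg _)
  filter_upwards [(tendsto_mul _).eventually_le_const (by positivity : 0 < ε ^ 2),
    self_mem_nhdsWithin] with δ hδε hδ
  exact hv.setIntegral_smoothPos_sub_sq_le ha hν hΛ hr hrR hM hMv hε hC poincare hδ hδε

theorem IsSubsolution.ae_le_add_of_sqrt_mul_le (hε : 0 < ε) :
    ∀ᵐ x ∂volume.restrict (ball x₀ (5 / 9 * r)), v x ≤ M + 3 * ε := by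
  have memLp_v : MemLp v 2 (volume.restrict (ball x₀ (5 / 9 * r))) :=
    (hv.memLp_closedBall hrR).mono_measure (Measure.restrict_mono
      (ball_subset_closedBall.trans (closedBall_subset_closedBall (by linarith))) le_rfl)
  have integrable : Integrable (fun x => smoothPos ε (v x - (M + 3 * ε)) ^ 2)
      (volume.restrict (ball x₀ (5 / 9 * r))) :=
    ((lipschitzWith_smoothPos_sub hε (M + 3 * ε)).comp_memLp
      (smoothPos_of_nonpos hε (by linarith)) memLp_v).integrable_sq
  have ae_eq_zero := (integral_eq_zero_iff_of_nonneg (fun x => sq_nonneg _) integrable).1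
    (hv.setIntegral_smoothPos_sub_sq_eq_zero ha hν hΛ hr hrR hM hMv hε)
  filter_upwards [ae_eq_zero] with x hx
  by_contra! hlt
  exact (pow_pos (smoothPos_pos ε (sub_pos.2 hlt)) 2).ne' hx

theorem IsSubsolution.ae_le_of_sqrt_mul_le :
    ∀ᵐ x ∂volume.restrict (ball x₀ (5 / 9 * r)), v x ≤ M := by
  have ae_le (n : ℕ) := hv.ae_le_add_of_sqrt_mul_le ha hν hΛ hr hrR hM hMv
    (Nat.one_div_pos_of_nat (α := ℝ) (n := n))
  filter_upwards [ae_all_iff.2 ae_le] with x hx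
  have tendsto : Filter.Tendsto (fun n : ℕ => M + 3 * (1 / ((n : ℝ) + 1))) Filter.atTop
      (nhds (M + 3 * 0)) := (tendsto_one_div_add_atTop_nhds_zero_nat.const_mul 3).const_add M
  simpa using ge_of_tendsto' tendsto hx

end IsSubsolution

theorem volume_real_ball (x₀ : Plane) {R : ℝ} (hR : 0 ≤ R) :
    volume.real (ball x₀ R) = Real.pi * R ^ 2 := by
  rw [Measure.real, EuclideanSpace.volume_ball_fin_two, ENNReal.toReal_mul, ENNReal.toReal_pow,
    ENNReal.toReal_ofReal hR, mul_comm, ENNReal.toReal_ofReal Real.pi_pos.le]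

theorem setAverage_posPart_sq_nonneg (B : Set Plane) (v : Plane → ℝ) :
    0 ≤ ⨍ x in B, (max (v x) 0) ^ 2 := by
  rw [setAverage_eq]
  exact smul_nonneg (by positivity) (integral_nonneg fun x => sq_nonneg _)

theorem posPartAvgNorm_nonneg (B : Set Plane) (v : Plane → ℝ) : 0 ≤ posPartAvgNorm B v :=
  Real.rpow_nonneg (setAverage_posPart_sq_nonneg B v) _

theorem posPartAvgNorm_sq (B : Set Plane) (v : Plane → ℝ) :
    posPartAvgNorm B v ^ 2 = (∫ x in B, (max (v x) 0) ^ 2) / volume.real B := by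
  rw [posPartAvgNorm, ← Real.sqrt_eq_rpow, Real.sq_sqrt (setAverage_posPart_sq_nonneg B v),
    setAverage_eq, smul_eq_mul, inv_mul_eq_div]

theorem localMaxEstimate_quarter (x₀ : Plane) {R : ℝ} (hR : 0 < R) :
    LocalMaxEstimate x₀ R 512 (1 / 4) := by
  intro ν Λ hν hΛ a ha v _ hv
  set p := posPartAvgNorm (ball x₀ R) v
  have p_nonneg : 0 ≤ p := posPartAvgNorm_nonneg (ball x₀ R) v
  have ratio_pos : 0 < Λ / ν := div_pos (hν.trans_le hΛ) hν
  have rpow_sq : ((Λ / ν) ^ (1 / 4 : ℝ)) ^ 2 = √(Λ / ν) := by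
    rw [← Real.rpow_natCast, ← Real.rpow_mul ratio_pos.le, Real.sqrt_eq_rpow]
    norm_num
  have integral_eq : ∫ x in ball x₀ R, (max (v x) 0) ^ 2 = p ^ 2 * (Real.pi * R ^ 2) := by
    rw [posPartAvgNorm_sq, volume_real_ball x₀ hR.le, div_mul_cancel₀]
    positivity
  have bound : √(Λ / ν) * (46728 / (9 / 10 * R) ^ 2 * ∫ x in ball x₀ R, (max (v x) 0) ^ 2) ≤
      (512 * (Λ / ν) ^ (1 / 4 : ℝ) * p) ^ 2 := by
    calc _ = √(Λ / ν) * p ^ 2 * (4672800 / 81 * Real.pi) := by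
          rw [integral_eq]
          field_simp
          ring
      _ ≤ √(Λ / ν) * p ^ 2 * 512 ^ 2 := by
          gcongr
          linarith [Real.pi_le_four]
      _ = _ := by
          rw [mul_pow, mul_pow, rpow_sq]
          ring
  have ae_le := hv.ae_le_of_sqrt_mul_le ha hν hΛ (by positivity : 0 < 9 / 10 * R) (by linarith)
    (by positivity) bound
  rw [show 5 / 9 * (9 / 10 * R) = R / 2 by ring] at ae_le
  exact essSup_le_of_ae_le _ (ae_le.mono fun x hx => EReal.coe_le_coe_iff.2 hx)

/-! ### Optimality of the exponent -/

section integral_mul_gradient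

variable {ι : Type*} [Fintype ι] {f φ : EuclideanSpace ℝ ι → ℝ} (hf : ContDiff ℝ 1 f)
  (hφ : ContDiff ℝ 1 φ) (hc : HasCompactSupport φ) (i : ι)
include hf hφ hc

theorem integrable_mul_gradient : Integrable fun x => f x * (∇ φ x) i := by
  have continuous_f := hf.continuous
  have continuous_grad := continuous_gradient hφ
  refine Continuous.integrable_of_hasCompactSupport (by fun_prop)
    (HasCompactSupport.mul_left (hc.mono' fun x hx => ?_))
  contrapose! hx
  simp [gradient_eq_zero_of_notMem_tsupport hx]

theorem integral_mul_gradient : ∫ x, f x * (∇ φ x) i = -∫ x, φ x * (∇ f x) i := by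
  have continuous_f := hf.continuous
  have continuous_φ := hφ.continuous
  have continuous_grad := continuous_gradient hf
  have integrable_f_grad := integrable_mul_gradient hf hφ hc i
  have integrable_grad_φ : Integrable fun x => (∇ f x) i * φ x :=
    Continuous.integrable_of_hasCompactSupport (by fun_prop) hc.mul_left
  have integrable_f_φ : Integrable fun x => f x * φ x :=
    Continuous.integrable_of_hasCompactSupport (by fun_prop) hc.mul_left
  classical
  simp only [gradient_euclideanSpace_apply] at integrable_f_grad integrable_grad_φ ⊢
  rw [integral_mul_fderiv_eq_neg_fderiv_mul_of_integrable integrable_grad_φ integrable_f_grad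
    integrable_f_φ (fun x _ => hf.differentiable one_ne_zero x)
    fun x _ => hφ.differentiable one_ne_zero x]
  simp only [mul_comm]

end integral_mul_gradient

theorem setIntegral_eq_integral_of_gradient {F : Type*} [NormedAddCommGroup F]
    [InnerProductSpace ℝ F] [CompleteSpace F] [MeasurableSpace F] {μ : Measure F} {φ : F → ℝ}
    {B : Set F} (hφ : tsupport φ ⊆ B) {f : F → ℝ} (hf : ∀ x, ∇ φ x = 0 → f x = 0) :
    ∫ x in B, f x ∂μ = ∫ x, f x ∂μ :=
  setIntegral_eq_integral_of_forall_compl_eq_zero fun _ hx =>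
    hf _ (gradient_eq_zero_of_notMem_tsupport fun h => hx (hφ h))

theorem hasW12Gradient_of_contDiff {B : Set Plane} (hB : Bornology.IsBounded B) {v : Plane → ℝ}
    (hv : ContDiff ℝ 1 v) : HasW12Gradient B v (∇ v) where
  memLp := (memLp_restrict_of_isCompact hv.continuous hB.isCompact_closure
    isClosed_closure.measurableSet 2).mono_measure (Measure.restrict_mono subset_closure le_rfl)
  memLp_grad := (memLp_restrict_of_isCompact (continuous_gradient hv) hB.isCompact_closure
    isClosed_closure.measurableSet 2).mono_measure (Measure.restrict_mono subset_closure le_rfl)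
  integral_eq φ hφ hc hs i := by
    rw [setIntegral_eq_integral_of_gradient hs fun x hx => by simp [hx],
      integral_mul_gradient hv (hφ.of_le (by simp)) hc i,
      setIntegral_eq_integral_of_forall_compl_eq_zero fun x hx => by
        rw [image_eq_zero_of_notMem_tsupport fun h => hx (hs h), zero_mul]]

theorem le_supOn {S : Set Plane} (hS : IsOpen S) {v : Plane → ℝ} (hv : Continuous v) {x : Plane}
    (hx : x ∈ S) : (v x : EReal) ≤ supOn S v := by
  have continuous_v : Continuous fun y => (v y : EReal) := continuous_coe_real_ereal.comp hv
  have min_ae_eq : (fun y => min (v y : EReal) (supOn S v)) =ᵐ[volume.restrict S]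
      fun y => (v y : EReal) :=
    (ae_le_essSup (f := fun y => (v y : EReal))).mono fun y hy => min_eq_left hy
  exact min_eq_left_iff.1 (Measure.eqOn_open_of_ae_eq min_ae_eq hS
    (continuous_v.min continuous_const).continuousOn continuous_v.continuousOn hx)

theorem posPartAvgNorm_pos {B : Set Plane} (hB : IsOpen B) (hB' : Bornology.IsBounded B)
    {v : Plane → ℝ} (hv : Continuous v) {x : Plane} (hx : x ∈ B) (hvx : 0 < v x) :
    0 < posPartAvgNorm B v := by
  have continuous_sq : Continuous fun y => (max (v y) 0) ^ 2 := by fun_prop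
  have integrable : IntegrableOn (fun y => (max (v y) 0) ^ 2) B :=
    (continuous_sq.continuousOn.integrableOn_compact hB'.isCompact_closure).mono_set subset_closure
  have integral_pos : 0 < ∫ y in B, (max (v y) 0) ^ 2 :=
    (setIntegral_pos_iff_support_of_nonneg_ae (.of_forall fun y => sq_nonneg _) integrable).2
      ((continuous_sq.isOpen_support.inter hB).measure_pos volume ⟨x, by simp [hvx], hx⟩)
  have volume_pos : 0 < volume.real B :=
    ENNReal.toReal_pos (hB.measure_pos volume ⟨x, hx⟩).ne' hB'.measure_lt_top.ne
  refine (posPartAvgNorm_nonneg B v).lt_of_ne' fun h => ?_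
  have := div_pos integral_pos volume_pos
  rw [← posPartAvgNorm_sq, h] at this
  norm_num at this

theorem volume_setOf_forall_abs_sub_le {ι : Type*} [Fintype ι] (c : EuclideanSpace ℝ ι)
    {l : ι → ℝ} (hl : ∀ i, 0 ≤ l i) :
    volume {x : EuclideanSpace ℝ ι | ∀ i, |x i - c i| ≤ l i} =
      ENNReal.ofReal (∏ i, 2 * l i) := by
  have preimage_eq : {x : EuclideanSpace ℝ ι | ∀ i, |x i - c i| ≤ l i} =
      WithLp.ofLp ⁻¹' Set.univ.pi fun i => closedBall (c i) (l i) := by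
    ext x
    simp [Real.dist_eq]
  rw [preimage_eq, (PiLp.volume_preserving_ofLp ι).measure_preimage
    (MeasurableSet.univ_pi fun i => measurableSet_closedBall).nullMeasurableSet, volume_pi_pi,
    ENNReal.ofReal_prod_of_nonneg fun i _ => by linarith [hl i]]
  simp only [Real.volume_closedBall]

theorem isEllipticOn_diagonal (B : Set Plane) {Λ : ℝ} (hΛ : 1 ≤ Λ) :
    IsEllipticOn B 1 Λ fun _ => Matrix.diagonal ![1, Λ] where
  memLp i j := memLp_top_const _
  symm := .of_forall fun _ => Matrix.isSymm_diagonal _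
  bounds := .of_forall fun _ z => by
    have form_eq : (Matrix.diagonal ![1, Λ] *ᵥ z.ofLp) ⬝ᵥ z.ofLp = z 0 ^ 2 + Λ * z 1 ^ 2 := by
      simp [dotProduct, Matrix.mulVec_diagonal, Fin.sum_univ_two]
      ring
    rw [form_eq, EuclideanSpace.real_norm_sq_eq, Fin.sum_univ_two]
    constructor <;> nlinarith [sq_nonneg (z 0), sq_nonneg (z 1)]

/-- The function `1 + y₂² - Λ y₁²` in the coordinates `y = (x - x₀) / R`: the extremal example on
`B_R(x₀)`, whose positive part lives on a strip of width comparable to `Λ^(-1/2) R`. -/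
noncomputable def saddle (x₀ : Plane) (R Λ : ℝ) (x : Plane) : ℝ :=
  1 + ((x 1 - x₀ 1) / R) ^ 2 - Λ * ((x 0 - x₀ 0) / R) ^ 2

section saddle

variable (x₀ : Plane) {R Λ : ℝ}

theorem saddle_zero_one (Λ : ℝ) : saddle 0 1 Λ = fun x => 1 + x 1 ^ 2 - Λ * x 0 ^ 2 := by
  ext x
  simp [saddle]

theorem saddle_center (R Λ : ℝ) : saddle x₀ R Λ x₀ = 1 := by simp [saddle]

theorem contDiff_coord_sub (i : Fin 2) : ContDiff ℝ 1 fun x : Plane => x i - x₀ i :=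
  (EuclideanSpace.proj (𝕜 := ℝ) i).contDiff.sub contDiff_const

theorem contDiff_saddle (R Λ : ℝ) : ContDiff ℝ 1 (saddle x₀ R Λ) :=
  (contDiff_const.add (((contDiff_coord_sub x₀ 1).div_const R).pow 2)).sub
    (contDiff_const.mul (((contDiff_coord_sub x₀ 0).div_const R).pow 2))

theorem hasFDerivAt_coord_sub (i : Fin 2) (x : Plane) :
    HasFDerivAt (fun x : Plane => x i - x₀ i) (EuclideanSpace.proj (𝕜 := ℝ) i : Plane →L[ℝ] ℝ) x :=
  (EuclideanSpace.proj (𝕜 := ℝ) i : Plane →L[ℝ] ℝ).hasFDerivAt.sub_const _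

theorem gradient_saddle (R Λ : ℝ) (x : Plane) :
    ∇ (saddle x₀ R Λ) x = (2 / R ^ 2) • !₂[-Λ * (x 0 - x₀ 0), x 1 - x₀ 1] := by
  have hasFDerivAt_sq (i : Fin 2) := ((hasFDerivAt_coord_sub x₀ i x).mul_const R⁻¹).pow 2
  have hasFDerivAt_saddle : HasFDerivAt (saddle x₀ R Λ) _ x :=
    ((hasFDerivAt_sq 1).const_add 1).sub ((hasFDerivAt_sq 0).const_mul Λ)
  ext i
  rw [gradient_euclideanSpace_apply, hasFDerivAt_saddle.fderiv]
  fin_cases i <;> simp <;> ring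

theorem integral_coord_sub_mul_gradient {φ : Plane → ℝ} (hφ : ContDiff ℝ 1 φ)
    (hc : HasCompactSupport φ) (i : Fin 2) : ∫ x, (x i - x₀ i) * (∇ φ x) i = -∫ x, φ x := by
  rw [integral_mul_gradient (contDiff_coord_sub x₀ i) hφ hc i]
  simp [gradient_euclideanSpace_apply, (hasFDerivAt_coord_sub x₀ i _).fderiv]

theorem isSubsolution_saddle {B : Set Plane} (hB : Bornology.IsBounded B) (R Λ : ℝ) :
    IsSubsolution B (fun _ => Matrix.diagonal ![1, Λ]) (saddle x₀ R Λ) := by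
  refine ⟨∇ (saddle x₀ R Λ), hasW12Gradient_of_contDiff hB (contDiff_saddle x₀ R Λ),
    fun φ hφ hc hs _ => le_of_eq ?_⟩
  have form_eq (x : Plane) :
      (Matrix.diagonal ![1, Λ] *ᵥ (∇ (saddle x₀ R Λ) x).ofLp) ⬝ᵥ (∇ φ x).ofLp =
        2 * Λ / R ^ 2 * ((x 1 - x₀ 1) * (∇ φ x) 1 - (x 0 - x₀ 0) * (∇ φ x) 0) := by
    simp [gradient_saddle, dotProduct, Matrix.mulVec_diagonal, Fin.sum_univ_two]
    ring
  rw [setIntegral_eq_integral_of_gradient hs fun x hx => by simp [hx]]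
  simp only [form_eq]
  rw [integral_const_mul, integral_sub (integrable_mul_gradient (contDiff_coord_sub x₀ 1) hφ hc 1)
    (integrable_mul_gradient (contDiff_coord_sub x₀ 0) hφ hc 0),
    integral_coord_sub_mul_gradient x₀ hφ hc, integral_coord_sub_mul_gradient x₀ hφ hc, sub_self,
    mul_zero]

variable {x₀} {x : Plane}

theorem abs_sub_le_of_mem_ball (hx : x ∈ ball x₀ R) (i : Fin 2) : |x i - x₀ i| ≤ R :=
  (PiLp.norm_apply_le (x - x₀) i).trans (mem_ball_iff_norm.1 hx).le

theorem sq_div_le_one_of_mem_ball (hx : x ∈ ball x₀ R) (i : Fin 2) :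
    ((x i - x₀ i) / R) ^ 2 ≤ 1 := by
  have hR : 0 < R := pos_of_mem_ball hx
  rw [sq_le_one_iff_abs_le_one, abs_div, abs_of_pos hR]
  exact div_le_one_of_le₀ (abs_sub_le_of_mem_ball hx i) hR.le

theorem saddle_le_two (hΛ : 0 ≤ Λ) (hx : x ∈ ball x₀ R) : saddle x₀ R Λ x ≤ 2 := by
  have := sq_div_le_one_of_mem_ball hx 1
  have : 0 ≤ Λ * ((x 0 - x₀ 0) / R) ^ 2 := by positivity
  unfold saddle
  linarith

theorem abs_sub_le_of_saddle_pos (hR : 0 < R) (hΛ : 0 < Λ) (hx : x ∈ ball x₀ R)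
    (h : 0 < saddle x₀ R Λ x) : |x 0 - x₀ 0| ≤ 3 / 2 * R / √Λ := by
  have := sq_div_le_one_of_mem_ball hx 1
  have mul_sq_lt : Λ * ((x 0 - x₀ 0) / R) ^ 2 < 2 := by
    unfold saddle at h
    linarith
  rw [div_pow, mul_div_assoc', div_lt_iff₀ (by positivity)] at mul_sq_lt
  refine abs_le_of_sq_le_sq ?_ (by positivity)
  rw [div_pow, Real.sq_sqrt hΛ.le, le_div_iff₀ hΛ]
  nlinarith [sq_nonneg R]

theorem setIntegral_posPart_saddle_sq_le (hR : 0 < R) (hΛ : 0 < Λ) :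
    ∫ x in ball x₀ R, (max (saddle x₀ R Λ x) 0) ^ 2 ≤ 24 * R ^ 2 / √Λ := by
  set S := {x : Plane | ∀ i, |x i - x₀ i| ≤ ![3 / 2 * R / √Λ, R] i}
  have nonneg : ∀ i : Fin 2, 0 ≤ ![3 / 2 * R / √Λ, R] i :=
    Fin.forall_fin_two.2 ⟨show 0 ≤ 3 / 2 * R / √Λ by positivity, hR.le⟩
  have volume_S : volume S = ENNReal.ofReal (6 * R ^ 2 / √Λ) := by
    rw [volume_setOf_forall_abs_sub_le x₀ nonneg, Fin.prod_univ_two]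
    congr 1
    simp only [Matrix.cons_val_zero, Matrix.cons_val_one]
    ring
  have eq_zero {x : Plane} (hx : x ∈ ball x₀ R \ (ball x₀ R ∩ S)) :
      (max (saddle x₀ R Λ x) 0) ^ 2 = 0 := by
    have nonpos : saddle x₀ R Λ x ≤ 0 := by
      by_contra! pos
      exact hx.2 ⟨hx.1, Fin.forall_fin_two.2 ⟨abs_sub_le_of_saddle_pos hR hΛ hx.1 pos,
        abs_sub_le_of_mem_ball hx.1 1⟩⟩
    rw [max_eq_right nonpos, zero_pow two_ne_zero]
  have norm_le {x : Plane} (hx : x ∈ ball x₀ R ∩ S) : ‖(max (saddle x₀ R Λ x) 0) ^ 2‖ ≤ 4 := by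
    rw [Real.norm_of_nonneg (sq_nonneg _), show (4 : ℝ) = 2 ^ 2 by norm_num]
    gcongr
    exact max_le (saddle_le_two hΛ.le hx.1) two_pos.le
  rw [setIntegral_eq_of_subset_of_forall_sdiff_eq_zero measurableSet_ball Set.inter_subset_left
    fun x hx => eq_zero hx]
  calc ∫ x in ball x₀ R ∩ S, (max (saddle x₀ R Λ x) 0) ^ 2
      ≤ 4 * volume.real (ball x₀ R ∩ S) :=
        (le_abs_self _).trans (norm_setIntegral_le_of_norm_le_const
          (measure_inter_lt_top_of_left_ne_top measure_ball_lt_top.ne) fun x hx => norm_le hx)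
    _ ≤ 4 * volume.real S := by
        gcongr
        · exact volume_S ▸ ENNReal.ofReal_ne_top
        · exact Set.inter_subset_right
    _ = 24 * R ^ 2 / √Λ := by
        rw [Measure.real, volume_S, ENNReal.toReal_ofReal (by positivity)]
        ring

theorem posPartAvgNorm_saddle_le (x₀ : Plane) (hR : 0 < R) (hΛ : 0 < Λ) :
    posPartAvgNorm (ball x₀ R) (saddle x₀ R Λ) ≤ 3 * Λ ^ (-(1 / 4) : ℝ) := by
  have rpow_sq : (Λ ^ (-(1 / 4) : ℝ)) ^ 2 = (√Λ)⁻¹ := by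
    rw [← Real.rpow_natCast, ← Real.rpow_mul hΛ.le, Real.sqrt_eq_rpow, ← Real.rpow_neg hΛ.le]
    norm_num
  refine le_of_sq_le_sq ?_ (by positivity)
  rw [posPartAvgNorm_sq, volume_real_ball x₀ hR.le, div_le_iff₀ (by positivity)]
  calc _ ≤ 24 * R ^ 2 / √Λ := setIntegral_posPart_saddle_sq_le hR hΛ
    _ = 9 * (√Λ)⁻¹ * (8 / 3 * R ^ 2) := by ring
    _ ≤ 9 * (√Λ)⁻¹ * (Real.pi * R ^ 2) := by
        gcongr
        linarith [Real.pi_gt_three]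
    _ = _ := by
        rw [mul_pow, rpow_sq]
        norm_num

theorem rpow_mul_posPartAvgNorm_saddle_le_supOn (x₀ : Plane) (hR : 0 < R) (hΛ : 0 < Λ) :
    ((1 / 3 * Λ ^ (1 / 4 : ℝ) * posPartAvgNorm (ball x₀ R) (saddle x₀ R Λ) : ℝ) : EReal) ≤
      supOn (ball x₀ (R / 2)) (saddle x₀ R Λ) := by
  refine le_trans (EReal.coe_le_coe_iff.2 ?_)
    (le_supOn isOpen_ball (contDiff_saddle x₀ R Λ).continuous (mem_ball_self (half_pos hR)))
  calc 1 / 3 * Λ ^ (1 / 4 : ℝ) * posPartAvgNorm (ball x₀ R) (saddle x₀ R Λ)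
      ≤ 1 / 3 * Λ ^ (1 / 4 : ℝ) * (3 * Λ ^ (-(1 / 4) : ℝ)) := by
        gcongr
        exact posPartAvgNorm_saddle_le x₀ hR hΛ
    _ = Λ ^ (1 / 4 : ℝ) * Λ ^ (-(1 / 4) : ℝ) := by ring
    _ = saddle x₀ R Λ x₀ := by
        rw [← Real.rpow_add hΛ, add_neg_cancel, Real.rpow_zero, saddle_center]

theorem posPartAvgNorm_saddle_pos (x₀ : Plane) (hR : 0 < R) (Λ : ℝ) :
    0 < posPartAvgNorm (ball x₀ R) (saddle x₀ R Λ) :=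
  posPartAvgNorm_pos isOpen_ball isBounded_ball (contDiff_saddle x₀ R Λ).continuous
    (mem_ball_self hR) (by simp [saddle_center])

theorem LocalMaxEstimate.rpow_le {c θ : ℝ} (h : LocalMaxEstimate x₀ R c θ) (hR : 0 < R)
    (hΛ : 1 ≤ Λ) : Λ ^ (1 / 4 - θ) ≤ 3 * c := by
  have Λ_pos : 0 < Λ := one_pos.trans_le hΛ
  have estimate := h 1 Λ one_pos hΛ _ (isEllipticOn_diagonal _ hΛ) (saddle x₀ R Λ)
    ⟨_, hasW12Gradient_of_contDiff isBounded_ball (contDiff_saddle x₀ R Λ)⟩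
    (isSubsolution_saddle x₀ isBounded_ball R Λ)
  have le : 1 / 3 * Λ ^ (1 / 4 : ℝ) ≤ c * Λ ^ θ := by
    have := EReal.coe_le_coe_iff.1
      ((rpow_mul_posPartAvgNorm_saddle_le_supOn x₀ hR Λ_pos).trans estimate)
    rw [div_one] at this
    exact le_of_mul_le_mul_right this (posPartAvgNorm_saddle_pos x₀ hR Λ)
  rw [Real.rpow_sub Λ_pos, div_le_iff₀ (by positivity)]
  linarith

end saddle

theorem not_localMaxEstimate (x₀ : Plane) {R : ℝ} (hR : 0 < R) {θ : ℝ} (hθ : θ < 1 / 4) (c : ℝ) :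
    ¬ LocalMaxEstimate x₀ R c θ := by
  intro h
  obtain ⟨Λ, rpow_gt, hΛ⟩ := (((tendsto_rpow_atTop (sub_pos.2 hθ)).eventually_gt_atTop (3 * c)).and
    (Filter.eventually_ge_atTop 1)).exists
  exact rpow_gt.not_ge (h.rpow_le hR hΛ)

theorem proposition2 :
    -- the estimate with exponent `1/4`, with a universal constant
    (∃ c : ℝ, ∀ (x₀ : Plane) (R : ℝ), 0 < R → LocalMaxEstimate x₀ R c (1 / 4)) ∧
    -- on no ball is there a finite constant for a smaller exponent
    (∀ (x₀ : Plane) (R : ℝ), 0 < R → ∀ θ : ℝ, θ < 1 / 4 → ¬ ∃ c : ℝ, LocalMaxEstimate x₀ R c θ) ∧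
    -- the example `v = 1 + x₂² - Λ x₁²`, `a = diag(1, Λ)` on the unit ball
    (∃ c₀ : ℝ, 0 < c₀ ∧ ∀ Λ : ℝ, 1 ≤ Λ →
      ∀ (a : Plane → Matrix (Fin 2) (Fin 2) ℝ) (v : Plane → ℝ),
        a = (fun _ => Matrix.diagonal ![1, Λ]) →
        v = (fun x => 1 + (x 1) ^ 2 - Λ * (x 0) ^ 2) →
        IsEllipticOn (ball 0 1) 1 Λ a ∧ MemW12 (ball 0 1) v ∧ IsSubsolution (ball 0 1) a v ∧
        0 < posPartAvgNorm (ball 0 1) v ∧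
        ((c₀ * Λ ^ (1 / 4 : ℝ) * posPartAvgNorm (ball 0 1) v : ℝ) : EReal)
          ≤ supOn (ball 0 (1 / 2)) v) := by
  refine ⟨⟨512, fun x₀ R hR => localMaxEstimate_quarter x₀ hR⟩,
    fun x₀ R hR θ hθ ⟨c, hc⟩ => not_localMaxEstimate x₀ hR hθ c hc, 1 / 3, by norm_num, ?_⟩
  rintro Λ hΛ a v rfl rfl
  rw [← saddle_zero_one]
  exact ⟨isEllipticOn_diagonal _ hΛ,
    ⟨_, hasW12Gradient_of_contDiff isBounded_ball (contDiff_saddle 0 1 Λ)⟩,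
    isSubsolution_saddle 0 isBounded_ball 1 Λ, posPartAvgNorm_saddle_pos 0 one_pos Λ,
    rpow_mul_posPartAvgNorm_saddle_le_supOn 0 one_pos (one_pos.trans_le hΛ)⟩
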